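/- **Theorem (Noether).** Let $X$ be a smooth $(n+1)$-dimensional manifold, possibly with boundary, with a volume form $\eta$ (a nowhere vanishing smooth $(n+1)$-form), let $\pi\colon Y\to X$ be a fibration with $m$-dimensional fibres (a surjective submersion admitting fibred coordinates $(x^\mu,y^i)$ around each point, so that $\partial Y=\pi^{-1}(\partial X)$), and let $Z=J^1\pi$ be its first jet bundle, with induced coordinates $(x^\mu,y^i,z^i_\mu)$ and projections $\pi_{YZ}\colon Z\to Y$, $\pi_{XZ}\colon Z\to X$. Let $L\colon Z\to\mathbb R$ be a smooth Lagrangian and let $$\Theta_L=L\,\eta+(S_\eta)^*(dL),\qquad\text{locally}\quad \Theta_L=L\,\eta+\frac{\partial L}{\partial z^i_\mu}\,\theta^i\wedge\iota_{\partial/\partial x^\mu}\eta,\qquad \theta^i=dy^i-z^i_\mu dx^\mu,$$ be its Poincaré–Cartan $(n+1)$-form, where $S_\eta$ is the vertical endomorphism. A contact $1$-form is a $1$-form $\theta$ on $Z$ with $(j^1\phi)^*\theta=0$ for all (local) sections $\phi$ of $\pi$, and $\mathcal I(\mathcal C)$ is the differential ideal generated by the contact $1$-forms. The $1$-jet prolongation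 $\xi_Y^{(1)}$ of a vector field $\xi_Y$ on $Y$ is the unique vector field on $Z$ that projects onto $\xi_Y$ and satisfies that $\pounds_{\xi_Y^{(1)}}\theta$ is a contact form for every contact $1$-form $\theta$. Let the boundary condition be a subbundle $B$ of $\partial Z=\pi_{XZ}^{-1}(\partial X)\to\partial X$ with inclusion $i_B\colon B\to Z$, and let $\Pi$ be an $n$-form on $B$ with $i_B^*\Theta_L=d\Pi$. Suppose that the vector field $\xi_Y$ on $Y$ is an infinitesimal symmetry of the Lagrangian, that is, $\pounds_{\xi_Y^{(1)}}\Theta_L\in\mathcal I(\mathcal C)$, the vector field $\xi_Y^{(1)}$ is tangent to $B$, and $\pounds_{\xi_Y^{(1)}|_B}\Pi=0$. Then: 1. $\iota_{\xi_Y^{(1)}}\Theta_L$ is a preserved quantity: it is an $n$-form on $Z$ with $$(j^1\phi)^*\,d\bigl(\iota_{\xi_Y^{(1)}}\Theta_L\bigr)=0$$ for every (local) section $\phi$ of $\pi$ that solves the Euler–Lagrange equations, i.e. such that in all fibred coordinates, with $L\,\eta=\Lambda\,dx^0\wedge\dots\wedge dx^n$, $$\frac{\partial\Lambda}{\partial y^i}(j^1\phi)-\sum_\mu\frac{\partial}{\partial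 x^\mu}\Bigl(\frac{\partial\Lambda}{\partial z^i_\mu}(j^1\phi)\Bigr)=0,\qquad 1\le i\le m.$$ 2. It is exact on the boundary: $i_B^*(\iota_{\xi_Y^{(1)}}\Theta_L)$ is an exact $n$-form on $B$ (for $n=0$ this means that it vanishes). -/

import Mathlib

open Set Filter Topology
open scoped Manifold ContDiff

/-! ### Fibrations and the first jet bundle as a smooth manifold -/

noncomputable section Jets

variable {E : Type*} [NormedAddCommGroup E] [NormedSpace ℝ E]
  {H : Type*} [TopologicalSpace H] {I : ModelWithCorners ℝ E H}
  {F : Type*} [NormedAddCommGroup F] [NormedSpace ℝ F]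
  {X : Type*} [TopologicalSpace X] [ChartedSpace H X]
  {Y : Type*} [TopologicalSpace Y] [ChartedSpace (ModelProd H F) Y]

variable (I F) in
/-- Fibred coordinates for `π : Y → X`: smooth charts `(x^μ, y^i)` of `Y` and `(x^μ)` of `X` in which
`π (x^μ, y^i) = (x^μ)`. -/
structure FiberedChart (π : Y → X) where
  total : OpenPartialHomeomorph Y (ModelProd H F)
  base : OpenPartialHomeomorph X H
  total_mem : total ∈ IsManifold.maximalAtlas (I.prod 𝓘(ℝ, F)) ∞ Y
  base_mem : base ∈ IsManifold.maximalAtlas I ∞ X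
  mapsTo : MapsTo π total.source base.source
  fst_eq : ∀ y ∈ total.source, (total y).1 = base (π y)

variable (I F X Y) in
/-- A fibration `π : Y → X`: a surjective submersion, in the form that fibred coordinates exist
around each point of `Y`. As the fibre model `F` has no boundary, `∂Y = π⁻¹(∂X)`. -/
structure Fibration where
  proj : Y → X
  surjective : Function.Surjective proj
  exists_chart : ∀ y, ∃ κ : FiberedChart I F proj, y ∈ κ.total.source

/-- The first jet bundle `Z = J¹π`: the jet `j¹_x φ` is the point `y = φ x` together with the linear
section `A = T_x φ : T_x X → T_y Y` of `T_y π`. -/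
structure Jet (p : Fibration I F X Y) where
  pt : Y
  lin : TangentSpace I (p.proj pt) →L[ℝ] TangentSpace (I.prod 𝓘(ℝ, F)) pt
  isSection : (mfderiv (I.prod 𝓘(ℝ, F)) I p.proj pt).comp lin = ContinuousLinearMap.id ℝ _

/-- The projection `π_{XZ} : Z → X`. The projection `π_{YZ} : Z → Y` is `Jet.pt`. -/
def Jet.base {p : Fibration I F X Y} (z : Jet p) : X := p.proj z.pt

/-- A choice of fibred coordinates around each point of `Y`. -/
def Fibration.fiberedChartAt (p : Fibration I F X Y) (y : Y) : FiberedChart I F p.proj :=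
  (p.exists_chart y).choose

variable (I F) in
lemma hasMFDerivAt_modelProd_fst (h : ModelProd H F) :
    HasMFDerivAt (M := ModelProd H F) (I.prod 𝓘(ℝ, F)) I (fun q : ModelProd H F => q.1) h
      (ContinuousLinearMap.fst ℝ E F) := by
  refine ⟨continuous_fst.continuousAt, ?_⟩
  have h0 : HasFDerivWithinAt (Prod.fst : E × F → E) (ContinuousLinearMap.fst ℝ E F)
    (range (I.prod 𝓘(ℝ, F))) (I h.1, h.2) := hasFDerivWithinAt_fst
  refine h0.congr_of_eventuallyEq (eventually_of_mem self_mem_nhdsWithin ?_) ?_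
  · rintro _ ⟨q, rfl⟩
    change I (I.symm (I q.1)) = I q.1
    rw [I.left_inv]
  · change I (I.symm (I h.1)) = I h.1
    rw [I.left_inv]

namespace FiberedChart
variable {p : Fibration I F X Y} (κ : FiberedChart I F p.proj)

/-- The tangent map of the chart of `Y`. -/
def dTotal (y : Y) : (E × F) →L[ℝ] (E × F) := mfderiv (I.prod 𝓘(ℝ, F)) (I.prod 𝓘(ℝ, F)) κ.total y
/-- The tangent map of the inverse chart of `Y`. -/
def dTotalSymm (h : ModelProd H F) : (E × F) →L[ℝ] (E × F) :=
  mfderiv (I.prod 𝓘(ℝ, F)) (I.prod 𝓘(ℝ, F)) κ.total.symm h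
/-- The tangent map of the chart of `X`. -/
def dBase (x : X) : E →L[ℝ] E := mfderiv I I κ.base x
/-- The tangent map of the inverse chart of `X`. -/
def dBaseSymm (h : H) : E →L[ℝ] E := mfderiv I I κ.base.symm h

lemma mdiffTotal : κ.total.MDifferentiable (I.prod 𝓘(ℝ, F)) (I.prod 𝓘(ℝ, F)) := by
  have h := IsManifold.maximalAtlas_subset_of_le (n := ∞) (m := 1) (by simp) κ.total_mem
  exact ⟨fun y hy => (mdifferentiableAt_of_mem_maximalAtlas h hy).mdifferentiableWithinAt,
    fun y hy => (mdifferentiableAt_symm_of_mem_maximalAtlas h hy).mdifferentiableWithinAt⟩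

lemma mdiffBase : κ.base.MDifferentiable I I := by
  have h := IsManifold.maximalAtlas_subset_of_le (n := ∞) (m := 1) (by simp) κ.base_mem
  exact ⟨fun y hy => (mdifferentiableAt_of_mem_maximalAtlas h hy).mdifferentiableWithinAt,
    fun y hy => (mdifferentiableAt_symm_of_mem_maximalAtlas h hy).mdifferentiableWithinAt⟩

lemma dTotalSymm_dTotal {y : Y} (hy : y ∈ κ.total.source) (v : E × F) :
    κ.dTotalSymm (κ.total y) (κ.dTotal y v) = v :=
  DFunLike.congr_fun (κ.mdiffTotal.symm_comp_deriv hy) v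

lemma dTotal_dTotalSymm {h : ModelProd H F} (hh : h ∈ κ.total.target) (v : E × F) :
    κ.dTotal (κ.total.symm h) (κ.dTotalSymm h v) = v :=
  DFunLike.congr_fun (κ.mdiffTotal.comp_symm_deriv hh) v

lemma dBaseSymm_dBase {x : X} (hx : x ∈ κ.base.source) (v : E) :
    κ.dBaseSymm (κ.base x) (κ.dBase x v) = v :=
  DFunLike.congr_fun (κ.mdiffBase.symm_comp_deriv hx) v

lemma dBase_dBaseSymm {x : X} (hx : x ∈ κ.base.source) (v : E) :
    κ.dBase x (κ.dBaseSymm (κ.base x) v) = v := by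
  have h : κ.dBase (κ.base.symm (κ.base x)) (κ.dBaseSymm (κ.base x) v) = v :=
    DFunLike.congr_fun (κ.mdiffBase.comp_symm_deriv (κ.base.map_source hx)) v
  rwa [κ.base.left_inv hx] at h

lemma mdifferentiableAt_proj {y : Y} (hy : y ∈ κ.total.source) :
    MDifferentiableAt (I.prod 𝓘(ℝ, F)) I p.proj y := by
  have h1 : MDifferentiableAt (I.prod 𝓘(ℝ, F)) I (fun y => κ.base.symm (κ.total y).1) y := by
    have hfst := (hasMFDerivAt_modelProd_fst I F (κ.total y)).mdifferentiableAt
    have := hfst.comp y (κ.mdiffTotal.mdifferentiableAt hy)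
    refine MDifferentiableAt.comp y (g := κ.base.symm) ?_ this
    apply κ.mdiffBase.mdifferentiableAt_symm
    rw [κ.fst_eq y hy]
    exact κ.base.map_source (κ.mapsTo hy)
  refine h1.congr_of_eventuallyEq ?_
  filter_upwards [κ.total.open_source.mem_nhds hy] with y' hy'
  rw [κ.fst_eq y' hy', κ.base.left_inv (κ.mapsTo hy')]

lemma fst_dTotal {y : Y} (hy : y ∈ κ.total.source) (v : E × F) :
    (κ.dTotal y v).1 = κ.dBase (p.proj y) (mfderiv (I.prod 𝓘(ℝ, F)) I p.proj y v) := by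
  have h1 := (hasMFDerivAt_modelProd_fst I F (κ.total y)).comp y (κ.mdiffTotal.mdifferentiableAt hy).hasMFDerivAt
  have h2 := (κ.mdiffBase.mdifferentiableAt (κ.mapsTo hy)).hasMFDerivAt.comp y
    (κ.mdifferentiableAt_proj hy).hasMFDerivAt
  have h3 := h2.congr_of_eventuallyEq (f₁ := (fun q : ModelProd H F => q.1) ∘ κ.total) (by
    filter_upwards [κ.total.open_source.mem_nhds hy] with y' hy'
    exact κ.fst_eq y' hy')
  exact DFunLike.congr_fun (hasMFDerivAt_unique h1 h3) v


/-- The jet with coordinates `(h, B)`. -/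
def ofCoord (h : ModelProd H F) (hh : h ∈ κ.total.target) (B : E →L[ℝ] F) : Jet p where
  pt := κ.total.symm h
  lin := ((κ.dTotalSymm h).comp ((ContinuousLinearMap.id ℝ E).prod B)).comp
    (κ.dBase (p.proj (κ.total.symm h)))
  isSection := by
    have hy := κ.total.map_target hh
    ext v
    have h1 := κ.fst_dTotal hy (κ.dTotalSymm h
      (((ContinuousLinearMap.id ℝ E).prod B) (κ.dBase (p.proj (κ.total.symm h)) v)))
    rw [κ.dTotal_dTotalSymm hh] at h1
    have h2 := congrArg (κ.dBaseSymm (κ.base (p.proj (κ.total.symm h)))) h1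
    replace h2 := h2.trans (κ.dBaseSymm_dBase (κ.mapsTo hy) _)
    exact h2.symm.trans (κ.dBaseSymm_dBase (κ.mapsTo hy) v)

/-- The coordinates `(x^μ, y^i, z^i_μ)` of a jet. -/
def coord (z : Jet p) : ModelProd (ModelProd H F) (E →L[ℝ] F) :=
  (κ.total z.pt, ((ContinuousLinearMap.snd ℝ E F).comp (κ.dTotal z.pt)).comp
    (z.lin.comp (κ.dBaseSymm (κ.base (p.proj z.pt)))))

lemma coord_snd_apply (z : Jet p) (v : E) : (κ.coord z).2 v =
    (κ.dTotal z.pt (z.lin (κ.dBaseSymm (κ.base (p.proj z.pt)) v))).2 := rfl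

lemma jet_ext {z z' : Jet p} (h : z.pt = z'.pt)
    (h' : ∀ v : E, (z.lin v : E × F) = (z'.lin v : E × F)) : z = z' := by
  obtain ⟨y, A, hA⟩ := z
  obtain ⟨y', A', hA'⟩ := z'
  obtain rfl : y = y' := h
  obtain rfl : A = A' := ContinuousLinearMap.ext h'
  rfl

lemma fst_dTotal_lin {z : Jet p} (hz : z.pt ∈ κ.total.source) (v : E) :
    (κ.dTotal z.pt (z.lin v)).1 = κ.dBase (p.proj z.pt) v := by
  exact (κ.fst_dTotal hz _).trans
    (congrArg (κ.dBase (p.proj z.pt)) (DFunLike.congr_fun z.isSection v))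

lemma ofCoord_coord {z : Jet p} (hz : z.pt ∈ κ.total.source) :
    κ.ofCoord (κ.coord z).1 (κ.total.map_source hz) (κ.coord z).2 = z := by
  have hp : κ.total.symm (κ.total z.pt) = z.pt := κ.total.left_inv hz
  refine jet_ext hp fun v => ?_
  change κ.dTotalSymm (κ.total z.pt) (κ.dBase (p.proj (κ.total.symm (κ.total z.pt))) v,
    (κ.coord z).2 (κ.dBase (p.proj (κ.total.symm (κ.total z.pt))) v)) = z.lin v
  rw [hp, coord_snd_apply, κ.dBaseSymm_dBase (κ.mapsTo hz), ← κ.fst_dTotal_lin hz]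
  exact κ.dTotalSymm_dTotal hz _

lemma coord_ofCoord {h : ModelProd H F} (hh : h ∈ κ.total.target) (B : E →L[ℝ] F) :
    κ.coord (κ.ofCoord h hh B) = (h, B) := by
  have hy := κ.total.map_target hh
  refine Prod.ext (κ.total.right_inv hh) (ContinuousLinearMap.ext fun v => ?_)
  rw [coord_snd_apply]
  change (κ.dTotal (κ.total.symm h) (κ.dTotalSymm h (((ContinuousLinearMap.id ℝ E).prod B)
    (κ.dBase (p.proj (κ.total.symm h))
      (κ.dBaseSymm (κ.base (p.proj (κ.total.symm h))) v))))).2 = B v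
  rw [κ.dTotal_dTotalSymm hh, κ.dBase_dBaseSymm (κ.mapsTo hy)]
  rfl

open Classical in
/-- The chart `(x^μ, y^i, z^i_μ)` of `Z` induced by fibred coordinates. (`z₀` is only the junk value
of the inverse outside the chart domain.) -/
def jetChart (z₀ : Jet p) : PartialEquiv (Jet p) (ModelProd (ModelProd H F) (E →L[ℝ] F)) where
  toFun := κ.coord
  invFun q := if hq : q.1 ∈ κ.total.target then κ.ofCoord q.1 hq q.2 else z₀
  source := {z | z.pt ∈ κ.total.source}
  target := {q | q.1 ∈ κ.total.target}
  map_source' _ hz := κ.total.map_source hz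
  map_target' q hq := by
    have hq' : q.1 ∈ κ.total.target := hq
    rw [dif_pos hq']
    exact κ.total.map_target hq
  left_inv' z hz := by
    have h : (κ.coord z).1 ∈ κ.total.target := κ.total.map_source hz
    rw [dif_pos h]
    exact κ.ofCoord_coord hz
  right_inv' q hq := by
    have hq' : q.1 ∈ κ.total.target := hq
    rw [dif_pos hq']
    exact κ.coord_ofCoord hq q.2

lemma jetChart_symm_apply (z₀ : Jet p) {q : ModelProd (ModelProd H F) (E →L[ℝ] F)}
    (hq : q.1 ∈ κ.total.target) : (κ.jetChart z₀).symm q = κ.ofCoord q.1 hq q.2 :=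
  dif_pos hq

variable (κ' : FiberedChart I F p.proj)

/-- The coordinate change on `Y`, read in the model vector space. -/
def trTotal : E × F → E × F :=
  (I.prod 𝓘(ℝ, F)) ∘ (κ.total.symm.trans κ'.total) ∘ (I.prod 𝓘(ℝ, F)).symm

/-- The coordinate change on `X`, read in the model vector space. -/
def trBase : E → E := I ∘ (κ'.base.symm.trans κ.base) ∘ I.symm

lemma contDiffOn_trTotal [IsManifold (I.prod 𝓘(ℝ, F)) ∞ Y] :
    ContDiffOn ℝ ∞ (κ.trTotal κ') ((I.prod 𝓘(ℝ, F)).symm ⁻¹' (κ.total.symm.trans κ'.total).source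
      ∩ range (I.prod 𝓘(ℝ, F))) := by
  have := (IsManifold.compatible_of_mem_maximalAtlas κ.total_mem κ'.total_mem)
  rw [contDiffGroupoid, mem_groupoid_of_pregroupoid] at this
  exact this.1

lemma contDiffOn_trBase [IsManifold I ∞ X] :
    ContDiffOn ℝ ∞ (κ.trBase κ') (I.symm ⁻¹' (κ'.base.symm.trans κ.base).source ∩ range I) := by
  have := (IsManifold.compatible_of_mem_maximalAtlas κ'.base_mem κ.base_mem)
  rw [contDiffGroupoid, mem_groupoid_of_pregroupoid] at this
  exact this.1

lemma dTotal_trans {h : ModelProd H F} (hh : h ∈ (κ.total.symm.trans κ'.total).source) (v : E × F) :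
    κ'.dTotal (κ.total.symm h) (κ.dTotalSymm h v) =
      fderivWithin ℝ (κ.trTotal κ') (range (I.prod 𝓘(ℝ, F))) ((I.prod 𝓘(ℝ, F)) h) v := by
  have hh' : h ∈ κ.total.target ∧ κ.total.symm h ∈ κ'.total.source := by simpa using hh
  have h1 := (κ'.mdiffTotal.mdifferentiableAt hh'.2).hasMFDerivAt.comp h
    (κ.mdiffTotal.mdifferentiableAt_symm hh'.1).hasMFDerivAt
  have h2 : HasFDerivWithinAt (κ.trTotal κ') ((κ'.dTotal (κ.total.symm h)).comp (κ.dTotalSymm h))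
    (range (I.prod 𝓘(ℝ, F))) ((I.prod 𝓘(ℝ, F)) h) := h1.2
  rw [h2.fderivWithin ((I.prod 𝓘(ℝ, F)).uniqueDiffOn _ (mem_range_self _))]
  rfl

lemma dBase_trans {h : H} (hh : h ∈ (κ'.base.symm.trans κ.base).source) (v : E) :
    κ.dBase (κ'.base.symm h) (κ'.dBaseSymm h v) =
      fderivWithin ℝ (κ.trBase κ') (range I) (I h) v := by
  have hh' : h ∈ κ'.base.target ∧ κ'.base.symm h ∈ κ.base.source := by simpa using hh
  have h1 := (κ.mdiffBase.mdifferentiableAt hh'.2).hasMFDerivAt.comp h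
    (κ'.mdiffBase.mdifferentiableAt_symm hh'.1).hasMFDerivAt
  have h2 : HasFDerivWithinAt (κ.trBase κ') ((κ.dBase (κ'.base.symm h)).comp (κ'.dBaseSymm h))
    (range I) (I h) := h1.2
  rw [h2.fderivWithin (I.uniqueDiffOn _ (mem_range_self _))]
  rfl


lemma contDiffOn_fderivWithin_trTotal [IsManifold (I.prod 𝓘(ℝ, F)) ∞ Y] :
    ContDiffOn ℝ ∞ (fderivWithin ℝ (κ.trTotal κ') (range (I.prod 𝓘(ℝ, F))))
      ((I.prod 𝓘(ℝ, F)).symm ⁻¹' (κ.total.symm.trans κ'.total).source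
        ∩ range (I.prod 𝓘(ℝ, F))) := by
  have ho := (κ.total.symm.trans κ'.total).open_source
  refine ((κ.contDiffOn_trTotal κ').fderivWithin
    ((I.prod 𝓘(ℝ, F)).uniqueDiffOn_preimage ho) (m := ∞) (by simp)).congr fun u hu => ?_
  rw [inter_comm, fderivWithin_inter]
  exact (ho.preimage (I.prod 𝓘(ℝ, F)).continuous_symm).mem_nhds hu.1

lemma contDiffOn_fderivWithin_trBase [IsManifold I ∞ X] :
    ContDiffOn ℝ ∞ (fderivWithin ℝ (κ.trBase κ') (range I))
      (I.symm ⁻¹' (κ'.base.symm.trans κ.base).source ∩ range I) := by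
  have ho := (κ'.base.symm.trans κ.base).open_source
  refine ((κ.contDiffOn_trBase κ').fderivWithin
    (I.uniqueDiffOn_preimage ho) (m := ∞) (by simp)).congr fun u hu => ?_
  rw [inter_comm, fderivWithin_inter]
  exact (ho.preimage I.continuous_symm).mem_nhds hu.1

/-- The change of jet coordinates, read in the model vector space. -/
def trJet (q : (E × F) × (E →L[ℝ] F)) : (E × F) × (E →L[ℝ] F) :=
  (κ.trTotal κ' q.1,
    ((ContinuousLinearMap.snd ℝ E F).comp
      (fderivWithin ℝ (κ.trTotal κ') (range (I.prod 𝓘(ℝ, F))) q.1)).comp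
    (((ContinuousLinearMap.id ℝ E).prod q.2).comp
      (fderivWithin ℝ (κ.trBase κ') (range I) (κ.trTotal κ' q.1).1)))

lemma contDiffOn_trJet [IsManifold I ∞ X] [IsManifold (I.prod 𝓘(ℝ, F)) ∞ Y] :
    ContDiffOn ℝ ∞ (κ.trJet κ') {q | q.1 ∈
      (I.prod 𝓘(ℝ, F)).symm ⁻¹' (κ.total.symm.trans κ'.total).source
        ∩ range (I.prod 𝓘(ℝ, F))} := by
  set S : Set ((E × F) × (E →L[ℝ] F)) := {q | q.1 ∈
      (I.prod 𝓘(ℝ, F)).symm ⁻¹' (κ.total.symm.trans κ'.total).source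
        ∩ range (I.prod 𝓘(ℝ, F))} with hS
  have hfst : MapsTo Prod.fst S ((I.prod 𝓘(ℝ, F)).symm ⁻¹' (κ.total.symm.trans κ'.total).source
        ∩ range (I.prod 𝓘(ℝ, F))) := fun q hq => hq
  have h1 : ContDiffOn ℝ ∞ (fun q : (E × F) × (E →L[ℝ] F) => κ.trTotal κ' q.1) S :=
    (κ.contDiffOn_trTotal κ').comp contDiff_fst.contDiffOn hfst
  have h2 : ContDiffOn ℝ ∞ (fun q : (E × F) × (E →L[ℝ] F) =>
      fderivWithin ℝ (κ.trTotal κ') (range (I.prod 𝓘(ℝ, F))) q.1) S :=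
    (κ.contDiffOn_fderivWithin_trTotal κ').comp contDiff_fst.contDiffOn hfst
  have h3 : ContDiffOn ℝ ∞ (fun q : (E × F) × (E →L[ℝ] F) =>
      fderivWithin ℝ (κ.trBase κ') (range I) (κ.trTotal κ' q.1).1) S := by
    refine (κ.contDiffOn_fderivWithin_trBase κ').comp h1.fst fun q hq => ?_
    obtain ⟨hq1, hq2⟩ := hq
    simp only [mem_preimage, OpenPartialHomeomorph.trans_source,
      OpenPartialHomeomorph.symm_source, mem_inter_iff] at hq1
    obtain ⟨ha, hb⟩ := hq1
    have hc : (κ.trTotal κ' q.1).1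
        = I (κ'.base (p.proj (κ.total.symm ((I.prod 𝓘(ℝ, F)).symm q.1)))) := by
      rw [← κ'.fst_eq _ hb]; rfl
    rw [hc]
    refine ⟨?_, mem_range_self _⟩
    simp only [mem_preimage, I.left_inv, OpenPartialHomeomorph.trans_source,
      OpenPartialHomeomorph.symm_source, mem_inter_iff]
    refine ⟨κ'.base.map_source (κ'.mapsTo hb), ?_⟩
    rw [κ'.base.left_inv (κ'.mapsTo hb)]
    exact κ.mapsTo (κ.total.map_target ha)
  have h4 : ContDiffOn ℝ ∞ (fun q : (E × F) × (E →L[ℝ] F) =>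
      (ContinuousLinearMap.id ℝ E).prod q.2) S := by
    have : ContDiff ℝ ∞ (fun q : (E × F) × (E →L[ℝ] F) =>
        (ContinuousLinearMap.prodMapL ℝ E E E F (ContinuousLinearMap.id ℝ E, q.2)).comp
          ((ContinuousLinearMap.id ℝ E).prod (ContinuousLinearMap.id ℝ E))) := by
      fun_prop
    exact this.contDiffOn
  exact h1.prodMk ((contDiffOn_const.clm_comp h2).clm_comp (h4.clm_comp h3))

lemma jetChart_trans_eq (z₀ z₀' : Jet p) {q : ModelProd (ModelProd H F) (E →L[ℝ] F)}
    (hq : q.1 ∈ (κ.total.symm.trans κ'.total).source) :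
    ((I.prod 𝓘(ℝ, F)).prod 𝓘(ℝ, E →L[ℝ] F))
      (((κ.jetChart z₀).symm.trans (κ'.jetChart z₀')) q) =
      κ.trJet κ' (((I.prod 𝓘(ℝ, F)).prod 𝓘(ℝ, E →L[ℝ] F)) q) := by
  obtain ⟨h, B⟩ := q
  have hh : h ∈ κ.total.target ∧ κ.total.symm h ∈ κ'.total.source := by simpa using hq
  have h0 : ((κ.jetChart z₀).symm.trans (κ'.jetChart z₀')) (h, B)
      = κ'.coord (κ.ofCoord h hh.1 B) := by
    exact congrArg κ'.coord (κ.jetChart_symm_apply z₀ (q := (h, B)) hh.1)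
  rw [h0]
  have h1 : κ.trTotal κ' ((I.prod 𝓘(ℝ, F)) h) = (I.prod 𝓘(ℝ, F)) (κ'.total (κ.total.symm h)) := by
    simp only [trTotal, Function.comp, (I.prod 𝓘(ℝ, F)).left_inv]
    rfl
  refine Prod.ext h1.symm (ContinuousLinearMap.ext fun v => ?_)
  have hx := κ'.mapsTo hh.2
  have h2 : (κ.trTotal κ' ((I.prod 𝓘(ℝ, F)) h)).1 = I (κ'.base (p.proj (κ.total.symm h))) := by
    rw [h1, ← κ'.fst_eq _ hh.2]; rfl
  change (κ'.coord (κ.ofCoord h hh.1 B)).2 v = (fderivWithin ℝ (κ.trTotal κ')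
    (range (I.prod 𝓘(ℝ, F))) ((I.prod 𝓘(ℝ, F)) h) (((ContinuousLinearMap.id ℝ E).prod B)
      (fderivWithin ℝ (κ.trBase κ') (range I) (κ.trTotal κ' ((I.prod 𝓘(ℝ, F)) h)).1 v))).2
  rw [h2, ← κ.dBase_trans κ', ← κ.dTotal_trans κ' hq, κ'.base.left_inv hx]
  · rfl
  · simp only [OpenPartialHomeomorph.trans_source, OpenPartialHomeomorph.symm_source,
      mem_inter_iff, mem_preimage, κ'.base.left_inv hx]
    exact ⟨κ'.base.map_source hx, κ.mapsTo (κ.total.map_target hh.1)⟩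

lemma jetChart_trans_source (z₀ z₀' : Jet p) :
    ((κ.jetChart z₀).symm.trans (κ'.jetChart z₀')).source =
      {q | q.1 ∈ (κ.total.symm.trans κ'.total).source} := by
  ext q
  have hsrc : q.1 ∈ (κ.total.symm.trans κ'.total).source ↔
    q.1 ∈ κ.total.target ∧ κ.total.symm q.1 ∈ κ'.total.source := by simp
  refine Iff.trans ?_ hsrc.symm
  change (q.1 ∈ κ.total.target ∧ ((κ.jetChart z₀).symm q).pt ∈ κ'.total.source) ↔ _
  refine and_congr_right fun h => ?_
  rw [κ.jetChart_symm_apply z₀ h]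
  rfl

lemma contDiffOn_jetChart_trans [IsManifold I ∞ X] [IsManifold (I.prod 𝓘(ℝ, F)) ∞ Y]
    (z₀ z₀' : Jet p) :
    ContDiffOn ℝ ∞ (((I.prod 𝓘(ℝ, F)).prod 𝓘(ℝ, E →L[ℝ] F)) ∘
        ((κ.jetChart z₀).symm.trans (κ'.jetChart z₀')) ∘
        ((I.prod 𝓘(ℝ, F)).prod 𝓘(ℝ, E →L[ℝ] F)).symm)
      (((I.prod 𝓘(ℝ, F)).prod 𝓘(ℝ, E →L[ℝ] F)).symm ⁻¹'
        ((κ.jetChart z₀).symm.trans (κ'.jetChart z₀')).source ∩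
        range ((I.prod 𝓘(ℝ, F)).prod 𝓘(ℝ, E →L[ℝ] F))) := by
  rw [jetChart_trans_source]
  refine ((κ.contDiffOn_trJet κ').mono ?_).congr ?_
  · rintro _ ⟨hq, ⟨q, rfl⟩⟩
    exact ⟨hq, mem_range_self q.1⟩
  · rintro _ ⟨hq, ⟨q, rfl⟩⟩
    rw [mem_preimage, ModelWithCorners.left_inv] at hq
    rw [Function.comp_apply, Function.comp_apply, ModelWithCorners.left_inv]
    exact κ.jetChart_trans_eq κ' z₀ z₀' hq

end FiberedChart

namespace Jet

variable (p : Fibration I F X Y) [IsManifold I ∞ X] [IsManifold (I.prod 𝓘(ℝ, F)) ∞ Y]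

/-- The atlas of `Z` consisting of the charts induced by all fibred coordinates. -/
def core : ChartedSpaceCore (ModelProd (ModelProd H F) (E →L[ℝ] F)) (Jet p) where
  atlas := {e | ∃ (κ : FiberedChart I F p.proj) (z₀ : Jet p), e = κ.jetChart z₀}
  chartAt z := (p.fiberedChartAt z.pt).jetChart z
  mem_chart_source z := (p.exists_chart z.pt).choose_spec
  chart_mem_atlas z := ⟨_, _, rfl⟩
  open_source := by
    rintro _ _ ⟨κ, z₀, rfl⟩ ⟨κ', z₀', rfl⟩
    rw [FiberedChart.jetChart_trans_source]
    exact (κ.total.symm.trans κ'.total).open_source.preimage continuous_fst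
  continuousOn_toFun := by
    rintro _ _ ⟨κ, z₀, rfl⟩ ⟨κ', z₀', rfl⟩
    set K := (I.prod 𝓘(ℝ, F)).prod 𝓘(ℝ, E →L[ℝ] F) with hK
    have h := (κ.contDiffOn_jetChart_trans κ' z₀ z₀').continuousOn
    have h' := (K.continuous_symm.comp_continuousOn h).comp K.continuous.continuousOn
      (s := ((κ.jetChart z₀).symm.trans (κ'.jetChart z₀')).source) (fun q hq => by
        refine ⟨?_, mem_range_self q⟩
        rw [mem_preimage, K.left_inv]
        exact hq)
    refine h'.congr fun q hq => ?_
    simp only [Function.comp_apply, ← hK, K.left_inv]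

instance : TopologicalSpace (Jet p) := (core p).toTopologicalSpace

instance : ChartedSpace (ModelProd (ModelProd H F) (E →L[ℝ] F)) (Jet p) :=
  (core p).toChartedSpace

instance : IsManifold ((I.prod 𝓘(ℝ, F)).prod 𝓘(ℝ, E →L[ℝ] F)) ∞ (Jet p) := by
  refine isManifold_of_contDiffOn _ _ _ fun e e' he he' => ?_
  obtain ⟨_, ⟨κ, z₀, rfl⟩, rfl⟩ := mem_iUnion₂.1 he
  obtain ⟨_, ⟨κ', z₀', rfl⟩, rfl⟩ := mem_iUnion₂.1 he'
  exact κ.contDiffOn_jetChart_trans κ' z₀ z₀'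

end Jet

variable (p : Fibration I F X Y)

lemma nonempty_jet (x : X) : Nonempty (Jet p) := by
  obtain ⟨y, -⟩ := p.surjective x
  obtain ⟨κ, hκ⟩ := p.exists_chart y
  exact ⟨κ.ofCoord (κ.total y) (κ.total.map_source hκ) 0⟩

open Classical in
/-- The `1`-jet prolongation `j¹φ (x) = (φ x, T_x φ)` of a section `φ`. At points where `φ` is not
a section of `π` with `Tπ ∘ Tφ = id`, an arbitrary jet is used as junk value. -/
def jet1 (φ : X → Y) (x : X) : Jet p :=
  if h : p.proj (φ x) = x ∧
      ∀ v : E, mfderiv (I.prod 𝓘(ℝ, F)) I p.proj (φ x) (mfderiv I (I.prod 𝓘(ℝ, F)) φ x v) = v then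
    { pt := φ x
      lin := mfderiv I (I.prod 𝓘(ℝ, F)) φ x
      isSection := ContinuousLinearMap.ext h.2 }
  else Classical.choice (nonempty_jet p x)

end Jets

/-! ### Differential forms on manifolds (possibly with boundary) -/

noncomputable section Forms

variable {E : Type*} [NormedAddCommGroup E] [NormedSpace ℝ E]
  {H : Type*} [TopologicalSpace H] {I : ModelWithCorners ℝ E H}
  {M : Type*} [TopologicalSpace M] [ChartedSpace H M]
  {E' : Type*} [NormedAddCommGroup E'] [NormedSpace ℝ E']
  {H' : Type*} [TopologicalSpace H'] {I' : ModelWithCorners ℝ E' H'}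
  {M' : Type*} [TopologicalSpace M'] [ChartedSpace H' M']

variable (I M) in
/-- Differential `k`-forms on `M`; smoothness is the separate predicate `DForm.IsSmooth`. -/
abbrev DForm (k : ℕ) := ∀ x : M, TangentSpace I x [⋀^Fin k]→L[ℝ] ℝ

variable (I M) in
/-- Vector fields on `M`; smoothness is the separate predicate `IsSmoothVectorField`. -/
abbrev VField := ∀ x : M, TangentSpace I x

/-- Smoothness of a vector field, as a section of the tangent bundle. -/
def IsSmoothVectorField [IsManifold I ∞ M] (V : VField I M) : Prop :=
  ContMDiff I I.tangent ∞ (fun x => (⟨x, V x⟩ : TangentBundle I M))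

/-- The product `v ↦ α (v₀, …, v_{k-1}) * β (v_k, …, v_{k+l-1})` of two alternating maps. -/
def mulForms {k l : ℕ} (α : E [⋀^Fin k]→L[ℝ] ℝ) (β : E [⋀^Fin l]→L[ℝ] ℝ) :
    ContinuousMultilinearMap ℝ (fun _ : Fin (k + l) => E) ℝ where
  toFun v := α (v ∘ Fin.castAdd l) * β (v ∘ Fin.natAdd k)
  map_update_add' v i x y := by
    rename_i inst
    obtain rfl : inst = instDecidableEqFin (k + l) := Subsingleton.elim _ _
    have h1 : ∀ (a : Fin k) (b : Fin l), Fin.castAdd l a ≠ Fin.natAdd k b := fun a b h => by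
      have := congrArg Fin.val h
      simp at this
      omega
    induction i using Fin.addCases with
    | left i =>
      have h2 : ∀ x, Function.update v (Fin.castAdd l i) x ∘ Fin.castAdd l =
          Function.update (v ∘ Fin.castAdd l) i x := fun x =>
        Function.update_comp_eq_of_injective _ (Fin.castAdd_injective k l) _ _
      have h3 : ∀ x, Function.update v (Fin.castAdd l i) x ∘ Fin.natAdd k =
          v ∘ Fin.natAdd k := fun x =>
        Function.update_comp_eq_of_notMem_range _ _ (by rintro ⟨b, hb⟩; exact h1 _ _ hb.symm)
      simp only [h2, h3, ContinuousAlternatingMap.map_update_add, add_mul]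
    | right i =>
      have h2 : ∀ x, Function.update v (Fin.natAdd k i) x ∘ Fin.natAdd k =
          Function.update (v ∘ Fin.natAdd k) i x := fun x =>
        Function.update_comp_eq_of_injective _ (Fin.natAdd_injective l k) _ _
      have h3 : ∀ x, Function.update v (Fin.natAdd k i) x ∘ Fin.castAdd l =
          v ∘ Fin.castAdd l := fun x =>
        Function.update_comp_eq_of_notMem_range _ _ (by rintro ⟨b, hb⟩; exact h1 _ _ hb)
      simp only [h2, h3, ContinuousAlternatingMap.map_update_add, mul_add]
  map_update_smul' v i c x := by
    rename_i inst
    obtain rfl : inst = instDecidableEqFin (k + l) := Subsingleton.elim _ _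
    have h1 : ∀ (a : Fin k) (b : Fin l), Fin.castAdd l a ≠ Fin.natAdd k b := fun a b h => by
      have := congrArg Fin.val h
      simp at this
      omega
    induction i using Fin.addCases with
    | left i =>
      have h2 : ∀ x, Function.update v (Fin.castAdd l i) x ∘ Fin.castAdd l =
          Function.update (v ∘ Fin.castAdd l) i x := fun x =>
        Function.update_comp_eq_of_injective _ (Fin.castAdd_injective k l) _ _
      have h3 : ∀ x, Function.update v (Fin.castAdd l i) x ∘ Fin.natAdd k =
          v ∘ Fin.natAdd k := fun x =>
        Function.update_comp_eq_of_notMem_range _ _ (by rintro ⟨b, hb⟩; exact h1 _ _ hb.symm)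
      simp only [h2, h3, ContinuousAlternatingMap.map_update_smul, smul_eq_mul, mul_assoc]
    | right i =>
      have h2 : ∀ x, Function.update v (Fin.natAdd k i) x ∘ Fin.natAdd k =
          Function.update (v ∘ Fin.natAdd k) i x := fun x =>
        Function.update_comp_eq_of_injective _ (Fin.natAdd_injective l k) _ _
      have h3 : ∀ x, Function.update v (Fin.natAdd k i) x ∘ Fin.castAdd l =
          v ∘ Fin.castAdd l := fun x =>
        Function.update_comp_eq_of_notMem_range _ _ (by rintro ⟨b, hb⟩; exact h1 _ _ hb)
      simp only [h2, h3, ContinuousAlternatingMap.map_update_smul, smul_eq_mul, mul_left_comm]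
  cont := by
    refine Continuous.mul (α.cont.comp ?_) (β.cont.comp ?_) <;>
    exact continuous_pi fun _ => continuous_apply _

/-- The wedge product
`(α ∧ β)(v) = (1 / (k! l!)) ∑ σ, sign σ • α (v_{σ 0}, …) β (v_{σ k}, …)`. -/
def wedgeForms {k l : ℕ} (α : E [⋀^Fin k]→L[ℝ] ℝ) (β : E [⋀^Fin l]→L[ℝ] ℝ) :
    E [⋀^Fin (k + l)]→L[ℝ] ℝ :=
  ((k.factorial * l.factorial : ℝ)⁻¹) • (mulForms α β).alternatization

namespace DForm

variable {k l : ℕ}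

/-- The form `α` read in the preferred chart at `x₀`: its pullback along the inverse chart. -/
def inChart (α : DForm I M k) (x₀ : M) (u : E) : E [⋀^Fin k]→L[ℝ] ℝ :=
  (α ((extChartAt I x₀).symm u)).compContinuousLinearMap
    (mfderivWithin 𝓘(ℝ, E) I (extChartAt I x₀).symm (range I) u)

/-- Smoothness of a form: all its chart representatives are smooth. -/
def IsSmooth (α : DForm I M k) : Prop :=
  ∀ x₀ : M, ContDiffOn ℝ ∞ (α.inChart x₀) (extChartAt I x₀).target

/-- The pullback `f^* α`. -/
def pullback (f : M → M') (α : DForm I' M' k) : DForm I M k := fun x =>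
  (α (f x)).compContinuousLinearMap (mfderiv I I' f x)

/-- The exterior derivative `dα`, computed at each point in the preferred chart there. -/
def extD (α : DForm I M k) : DForm I M (k + 1) := fun x =>
  (extDerivWithin (α.inChart x) (range I) (extChartAt I x x)).compContinuousLinearMap
    (mfderiv I 𝓘(ℝ, E) (extChartAt I x) x)

/-- The interior product `ι_V α = α (V, ·, …, ·)`. -/
def contract (V : VField I M) (α : DForm I M (k + 1)) : DForm I M k := fun x =>
  ContinuousAlternatingMap.curryLeft (E := E) (α x) (V x)

/-- The Lie derivative `£_V α`, computed at each point in the preferred chart there by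
`(£_V α)(v₁, …, v_k) = (D α · V)(v₁, …, v_k) + ∑ i, α (v₁, …, D V · v_i, …, v_k)`.
In particular it does not presuppose that `V` has a flow, which can fail at boundary points. -/
def lieD (V : VField I M) (α : DForm I M k) : DForm I M k := fun x =>
  let u : E := extChartAt I x x
  let V' : E → E := VectorField.mpullbackWithin 𝓘(ℝ, E) I (extChartAt I x).symm V (range I)
  (fderivWithin ℝ (α.inChart x) (range I) u (V' u) +
    (α.inChart x u).fderivCompContinuousLinearMap (ContinuousLinearMap.id ℝ E)
      (fderivWithin ℝ V' (range I) u)).compContinuousLinearMap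
    (mfderiv I 𝓘(ℝ, E) (extChartAt I x) x)

/-- The wedge product of two forms. -/
def wedge (α : DForm I M k) (β : DForm I M l) : DForm I M (k + l) := fun x =>
  wedgeForms (E := E) (α x) (β x)

/-- Exactness of a form. There are no nonzero forms of degree `-1`, so an exact `0`-form is `0`. -/
def IsExact : {k : ℕ} → DForm I M k → Prop
  | 0, α => α = 0
  | _ + 1, α => ∃ σ : DForm I M _, σ.IsSmooth ∧ σ.extD = α

end DForm

end Forms

/-! ### Lagrangian field theory on the first jet bundle -/

noncomputable section FieldTheory

/-- The model space of the base, `ℝ^{n+1}`. -/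
abbrev BaseSpace (n : ℕ) := EuclideanSpace ℝ (Fin (n + 1))

/-- The model space of the fibres, `ℝ^m`. -/
abbrev FibreSpace (m : ℕ) := EuclideanSpace ℝ (Fin m)

/-- The model with corners of the total space `Y` of a fibration. -/
abbrev totalModel {n : ℕ} {H : Type*} [TopologicalSpace H]
    (I : ModelWithCorners ℝ (BaseSpace n) H) (m : ℕ) :=
  I.prod 𝓘(ℝ, FibreSpace m)

/-- The model with corners of the jet bundle `Z = J¹π`. -/
abbrev jetModel {n : ℕ} {H : Type*} [TopologicalSpace H]
    (I : ModelWithCorners ℝ (BaseSpace n) H) (m : ℕ) :=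
  (totalModel I m).prod 𝓘(ℝ, BaseSpace n →L[ℝ] FibreSpace m)

/-- The coordinate vector `∂/∂x^μ`. -/
abbrev coordVec {n : ℕ} (μ : Fin (n + 1)) : BaseSpace n := EuclideanSpace.single μ 1

/-- The coordinate covector `dx^μ`. -/
abbrev coordCovec {n : ℕ} (μ : Fin (n + 1)) : BaseSpace n →L[ℝ] ℝ := EuclideanSpace.proj μ

variable {n m : ℕ} {H : Type*} [TopologicalSpace H] {I : ModelWithCorners ℝ (BaseSpace n) H}
  {X : Type*} [TopologicalSpace X] [ChartedSpace H X] [IsManifold I ∞ X]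
  {Y : Type*} [TopologicalSpace Y] [ChartedSpace (ModelProd H (FibreSpace m)) Y]
  [IsManifold (totalModel I m) ∞ Y]
  (p : Fibration I (FibreSpace m) X Y)

/-- `φ` is a smooth section of `π` over the open set `U`. Values of `φ` outside `U` are
irrelevant. For `U = univ` this is a global section. -/
structure IsLocalSection (U : Set X) (φ : X → Y) : Prop where
  isOpen : IsOpen U
  contMDiffOn : ContMDiffOn I (totalModel I m) ∞ φ U
  proj_eq : ∀ x ∈ U, p.proj (φ x) = x

/-- A contact `1`-form: a smooth `1`-form on `Z` with `(j¹φ)^* θ = 0` for all sections `φ`. -/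
structure IsContact (θ : DForm (jetModel I m) (Jet p) 1) : Prop where
  isSmooth : θ.IsSmooth
  pullback_eq_zero : ∀ (U : Set X) (φ : X → Y), IsLocalSection p U φ →
    ∀ x ∈ U, DForm.pullback (I := I) (jet1 p φ) θ x = 0

/-- The differential ideal `𝓘(𝓒)` generated by the contact forms: the homogeneous elements of the
ideal of the exterior algebra generated by the contact `1`-forms and their differentials.
(By graded commutativity it does not matter on which side one multiplies.) -/
inductive InContactIdeal : (k : ℕ) → DForm (jetModel I m) (Jet p) k → Prop
  | zero (k : ℕ) : InContactIdeal k 0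
  | add {k : ℕ} {α β : DForm (jetModel I m) (Jet p) k} :
      InContactIdeal k α → InContactIdeal k β → InContactIdeal k (α + β)
  | wedge_contact {k : ℕ} {β : DForm (jetModel I m) (Jet p) k}
      {θ : DForm (jetModel I m) (Jet p) 1} :
      β.IsSmooth → IsContact p θ → InContactIdeal (k + 1) (β.wedge θ)
  | wedge_extD {k : ℕ} {β : DForm (jetModel I m) (Jet p) k}
      {θ : DForm (jetModel I m) (Jet p) 1} :
      β.IsSmooth → IsContact p θ → InContactIdeal (k + 2) (β.wedge θ.extD)

/-- `ξZ` is the `1`-jet prolongation `ξ_Y^{(1)}` of `ξY`: the vector field on `Z` which projects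
onto `ξY` and whose Lie derivative preserves the contact forms. -/
structure IsProlongation (ξY : VField (totalModel I m) Y)
    (ξZ : VField (jetModel I m) (Jet p)) : Prop where
  isSmooth : IsSmoothVectorField ξZ
  projects : ∀ z : Jet p,
    mfderiv (jetModel I m) (totalModel I m) (Jet.pt : Jet p → Y) z (ξZ z) = ξY z.pt
  preserves : ∀ θ, IsContact p θ → IsContact p (DForm.lieD ξZ θ)

/-- The vertical lift `f ↦ f^v = d/dt (z + t f) |_{t = 0}` from `T_x^* X ⊗ V_y π` to `T_z Z`, in the
coordinates `(x^μ, y^i, z^i_μ)` in which Mathlib represents `T_z Z`: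
`f^i_μ dx^μ ⊗ ∂/∂y^i ↦ f^i_μ ∂/∂z^i_μ`. -/
def verticalLift (z : Jet p) :
    (TangentSpace I (p.proj z.pt) →L[ℝ] TangentSpace (totalModel I m) z.pt) →L[ℝ]
      TangentSpace (jetModel I m) z :=
  let κ := p.fiberedChartAt z.pt
  (ContinuousLinearMap.inr ℝ (BaseSpace n × FibreSpace m) (BaseSpace n →L[ℝ] FibreSpace m)).comp
    ((ContinuousLinearMap.compL ℝ (BaseSpace n) (BaseSpace n × FibreSpace m) (FibreSpace m)
      ((ContinuousLinearMap.snd ℝ (BaseSpace n) (FibreSpace m)).comp (κ.dTotal z.pt))).comp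
    ((ContinuousLinearMap.compL ℝ (BaseSpace n) (BaseSpace n)
      (BaseSpace n × FibreSpace m)).flip (κ.dBaseSymm (κ.base (p.proj z.pt)))))

/-- The vertical differential `V ↦ Tπ_{YZ}(V) - Tφ (Tπ_{XZ}(V))` at `z = j¹_x φ`, with values in the
vertical vectors of `Y`. In coordinates it is `θ^i ⊗ ∂/∂y^i` with `θ^i = dy^i - z^i_μ dx^μ`. -/
def verticalDiff (z : Jet p) :
    TangentSpace (jetModel I m) z →L[ℝ] TangentSpace (totalModel I m) z.pt :=
  mfderiv (jetModel I m) (totalModel I m) (Jet.pt : Jet p → Y) z -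
    z.lin.comp (mfderiv (jetModel I m) I (Jet.base : Jet p → X) z)

/-- The Poincaré-Cartan `(n+1)`-form `Θ_L = L η + (S_η)^* (dL)`, where
`S_η = ∑ ν, (θ^i ∧ ι_{∂_ν} η) ⊗ ∂/∂z^i_ν` is the vertical endomorphism; that is,
`(S_η)^*(dL) = ∑ ν, [V ↦ dL ((dx^ν ⊗ verticalDiff V)^v)] ∧ ι_{∂_ν} η`.
(The sum over `ν` does not depend on the basis `∂_ν` of `T_x X`.) -/
def poincareCartan (η : DForm I X (n + 1)) (L : Jet p → ℝ) :
    DForm (jetModel I m) (Jet p) (n + 1) := fun z =>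
  let Tπ : TangentSpace (jetModel I m) z →L[ℝ] BaseSpace n :=
    mfderiv (jetModel I m) I (Jet.base : Jet p → X) z
  let dL : TangentSpace (jetModel I m) z →L[ℝ] ℝ := mfderiv (jetModel I m) 𝓘(ℝ, ℝ) L z
  let momentum (ν : Fin (n + 1)) : TangentSpace (jetModel I m) z →L[ℝ] ℝ :=
    dL.comp ((verticalLift p z).comp
      ((ContinuousLinearMap.smulRightL ℝ (BaseSpace n) (BaseSpace n × FibreSpace m)
        (coordCovec ν)).comp (verticalDiff p z)))
  let Lη : TangentSpace (jetModel I m) z [⋀^Fin (n + 1)]→L[ℝ] ℝ :=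
    L z • (η z.base).compContinuousLinearMap Tπ
  let SdL : TangentSpace (jetModel I m) z [⋀^Fin (n + 1)]→L[ℝ] ℝ :=
    ContinuousAlternatingMap.alternatizeUncurryFin
      (E := (BaseSpace n × FibreSpace m) × (BaseSpace n →L[ℝ] FibreSpace m))
      (∑ ν : Fin (n + 1), ContinuousLinearMap.smulRight (momentum ν)
        ((ContinuousAlternatingMap.curryLeft (E := BaseSpace n) (η z.base)
          (coordVec ν)).compContinuousLinearMap Tπ))
  Lη + SdL

/-- The Lagrangian density in fibred coordinates: the function `Λ (x^μ, y^i, z^i_μ)` with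
`L η = Λ dx^0 ∧ … ∧ dx^n`. It is `L` itself in coordinates with `η = dx^0 ∧ … ∧ dx^n`.
(`z₀` is only the junk value of the inverse chart outside its domain.) -/
def localLagrangian (η : DForm I X (n + 1)) (L : Jet p → ℝ)
    (κ : FiberedChart I (FibreSpace m) p.proj) (z₀ : Jet p)
    (q : (BaseSpace n × FibreSpace m) × (BaseSpace n →L[ℝ] FibreSpace m)) : ℝ :=
  L ((κ.jetChart z₀).symm ((jetModel I m).symm q)) *
    η (κ.base.symm (I.symm q.1.1)) (fun ν => κ.dBaseSymm (I.symm q.1.1) (coordVec ν))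

/-- The coordinate expression of `j¹φ`, as a function of the coordinates `x^μ`. -/
def jetInCoord (κ : FiberedChart I (FibreSpace m) p.proj) (φ : X → Y) (u : BaseSpace n) :
    (BaseSpace n × FibreSpace m) × (BaseSpace n →L[ℝ] FibreSpace m) :=
  jetModel I m (κ.coord (jet1 p φ (κ.base.symm (I.symm u))))

/-- The Euler-Lagrange equations `∂Λ/∂y^i - d/dx^μ (∂Λ/∂z^i_μ) = 0` along `φ` on `U`, in all fibred
coordinates. At boundary points the derivatives are one-sided. -/
def IsEulerLagrange (η : DForm I X (n + 1)) (L : Jet p → ℝ) (U : Set X) (φ : X → Y) : Prop :=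
  ∀ (κ : FiberedChart I (FibreSpace m) p.proj), ∀ x ∈ U, φ x ∈ κ.total.source →
    ∀ i : Fin m,
      let Λ := localLagrangian p η L κ (jet1 p φ x)
      let u : BaseSpace n := I (κ.base x)
      let dΛ := fun u' => fderivWithin ℝ Λ (range (jetModel I m)) (jetInCoord p κ φ u')
      dΛ u ((0, EuclideanSpace.single i 1), 0) -
        ∑ μ : Fin (n + 1), fderivWithin ℝ
          (fun u' => dΛ u' ((0, 0), (coordCovec μ).smulRight (EuclideanSpace.single i 1)))
          (range I) u (coordVec μ) = 0

/-- `α` is a preserved quantity for the Euler-Lagrange equations: an `n`-form on `Z` with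
`(j¹φ)^* dα = 0` for all solutions `φ`. -/
structure IsPreservedQuantity (η : DForm I X (n + 1)) (L : Jet p → ℝ)
    (α : DForm (jetModel I m) (Jet p) n) : Prop where
  isSmooth : α.IsSmooth
  pullback_extD_eq_zero : ∀ (U : Set X) (φ : X → Y), IsLocalSection p U φ →
    IsEulerLagrange p η L U φ → ∀ x ∈ U, DForm.pullback (I := I) (jet1 p φ) α.extD x = 0

variable {b : ℕ} {B : Type*} [TopologicalSpace B] [ChartedSpace (EuclideanSpace ℝ (Fin b)) B]
  [IsManifold (𝓡 b) ∞ B]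

variable (b) in
/-- A boundary condition: a subbundle `B` of `∂Z → ∂X`, given as a smooth manifold `B` with a smooth
embedding `iB : B → Z` such that `π_{XZ} ∘ iB` is a submersion onto `∂X` (the boundary has
dimension `n`). If `∂X` is empty, then so is `B`. -/
structure IsBoundaryCondition (iB : B → Jet p) : Prop where
  isSmoothEmbedding : Manifold.IsSmoothEmbedding (𝓡 b) (jetModel I m) ∞ iB
  range_eq : range (fun β => (iB β).base) = I.boundary X
  rank_eq : ∀ β : B, Module.finrank ℝ
    (mfderiv (𝓡 b) I (fun β => (iB β).base) β).range = n

/-- `ξY`, with prolongation `ξZ`, is an infinitesimal symmetry of the Lagrangian: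
`£_{ξZ} Θ_L ∈ 𝓘(𝓒)`, `ξZ` is tangent to `B`, and its restriction `ζ` to `B` satisfies
`£_ζ Π = 0`. -/
structure IsLagrangianSymmetry (η : DForm I X (n + 1)) (L : Jet p → ℝ) (iB : B → Jet p)
    (Pi : DForm (𝓡 b) B n) (ξY : VField (totalModel I m) Y)
    (ξZ : VField (jetModel I m) (Jet p)) : Prop where
  isProlongation : IsProlongation p ξY ξZ
  lieD_mem : InContactIdeal p (n + 1) (DForm.lieD ξZ (poincareCartan p η L))
  tangent : ∃ ζ : VField (𝓡 b) B, IsSmoothVectorField ζ ∧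
    (∀ β, mfderiv (𝓡 b) (jetModel I m) iB β (ζ β) = ξZ (iB β)) ∧ DForm.lieD ζ Pi = 0

end FieldTheory

set_option linter.unusedSectionVars false

/-! ### Cartan's formula and naturality of the exterior derivative -/

/-! ### Cartan's formula for forms on a normed space. -/

section VectorSpace

variable {E : Type*} [NormedAddCommGroup E] [NormedSpace ℝ E]
  {F : Type*} [NormedAddCommGroup F] [NormedSpace ℝ F]
  {G : Type*} [NormedAddCommGroup G] [NormedSpace ℝ G]

/-! Write `ξ` for the prolonged field and `Θ` for the Poincaré-Cartan form. Cartan's formula reads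
`£_ξ Θ = d (ι_ξ Θ) + ι_ξ dΘ`. Pull it back along `j¹φ` for a solution `φ`. The left side vanishes,
because it lies in the contact ideal (`IsLocalSection.pullback_of_inContactIdeal`). The last term
vanishes, because the Euler-Lagrange equations imply `(j¹φ)^* (ι_ξ dΘ) = 0` for every vector field
`ξ` (`IsEulerLagrange.pullback_contract_extD`). What remains is the conservation law. On `B`,
tangency gives `i_B^* (ι_ξ Θ) = ι_ζ (i_B^* Θ) = ι_ζ dΠ`, and `£_ζ Π = 0` turns this into `-d (ι_ζ
Π)`, or into `0` when `n = 0`.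

Three ingredients need work. Cartan's formula is a pointwise Leibniz computation in a chart
(`cartan_formula_extDerivWithin`); no flow is involved, and derivatives are taken within the range
of the model, so boundary points need no separate treatment.

Naturality of `d` is used only in the form that a form which pulls back to zero near a point has an
exterior derivative which pulls back to zero there (`DForm.extD_comp_mfderivWithin_eq_zero`). This
handles the generators `dθ` of the contact ideal.

The core is the meaning of `dΘ` in fibred coordinates. There `Θ` becomes `localCartan`: with `P w =
∑ (∂Λ/∂z_ν · w) ∂_ν` it is `Λ vol` plus the sum over all slots of `vol` with the base vector in that
slot replaced by `P` applied to the contact form `θ` of the vector there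
(`Jet.inChart_poincareCartan`). Let `σ` be `j¹φ` in coordinates. Any `ξ` is a vector tangent to `σ`
plus a vertical one. The tangent part contributes nothing, since `n + 2` vectors tangent to an `(n +
1)`-dimensional graph are dependent. On the vertical part, `dΘ (ξ, σ' e_0, …, σ' e_n)` is exactly
the Euler-Lagrange expression contracted with the `y`-component
(`extDerivWithin_localCartan_vertical`). -/

open ContinuousAlternatingMap in
lemma fderivCompContinuousLinearMap_apply_eq_sum_update {k : ℕ} (α : F [⋀^Fin k]→L[ℝ] ℝ)
    (A B : E →L[ℝ] F) (v : Fin k → E) :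
    α.fderivCompContinuousLinearMap A B v =
      ∑ i, α (Function.update (fun j => A (v j)) i (B (v i))) := by
  rw [fderivCompContinuousLinearMap_apply]
  refine Finset.sum_congr rfl fun i _ => congrArg α (funext fun j => ?_)
  by_cases h : j = i
  · subst h; simp
  · simp [h]

/-- Moving `w` from the front to slot `i` costs the sign `(-1)^i`. This turns the signed sums in the
exterior derivative into sums over replaced slots, the form in which the Lie derivative and the
Poincaré-Cartan form are written. -/
lemma neg_one_pow_smul_map_cons_removeNth {k : ℕ} (α : E [⋀^Fin (k + 1)]→L[ℝ] ℝ)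
    (i : Fin (k + 1)) (w : E) (v : Fin (k + 1) → E) :
    (-1 : ℤ) ^ (i : ℕ) • α (Matrix.vecCons w (i.removeNth v)) = α (Function.update v i w) := by
  rw [← Fin.insertNth_removeNth, ContinuousAlternatingMap.map_insertNth]

/-- Cartan's formula `£_V α = d (ι_V α) + ι_V dα` on a vector space. -/
lemma cartan_formula_extDerivWithin {k : ℕ} {α : E → E [⋀^Fin (k + 1)]→L[ℝ] ℝ} {V : E → E}
    {s : Set E} {u : E} (hα : DifferentiableWithinAt ℝ α s u)
    (hV : DifferentiableWithinAt ℝ V s u) (hs : UniqueDiffWithinAt ℝ s u) :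
    extDerivWithin (fun y => (α y).curryLeft (V y)) s u + (extDerivWithin α s u).curryLeft (V u) =
      fderivWithin ℝ α s u (V u) + (α u).fderivCompContinuousLinearMap (ContinuousLinearMap.id ℝ E)
        (fderivWithin ℝ V s u) := by
  let C : (E [⋀^Fin (k + 1)]→L[ℝ] ℝ) →L[ℝ] E →L[ℝ] E [⋀^Fin k]→L[ℝ] ℝ :=
    ContinuousAlternatingMap.curryLeftLI.toContinuousLinearMap
  have h0 : HasFDerivAt (fun a => C a) C (α u) := by fun_prop
  have h1 : HasFDerivWithinAt (fun y => (α y).curryLeft) (C.comp (fderivWithin ℝ α s u)) s u := by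
    have := HasFDerivAt.comp_hasFDerivWithinAt (G := E →L[ℝ] E [⋀^Fin k]→L[ℝ] ℝ) u h0
      hα.hasFDerivWithinAt
    exact this
  -- `ι_V α` is the pairing of `curryLeft ∘ α` with `V`, so Leibniz splits its derivative into a
  -- part with `DV` and a part with `Dα`.
  have h2 := h1.clm_apply hV.hasFDerivWithinAt
  ext v
  rw [extDerivWithin, h2.fderivWithin hs, extDerivWithin]
  simp only [ContinuousAlternatingMap.add_apply,
    fderivCompContinuousLinearMap_apply_eq_sum_update,
    ContinuousAlternatingMap.curryLeft_apply_apply,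
    ContinuousAlternatingMap.alternatizeUncurryFin_apply]
  rw [Fin.sum_univ_succ (n := k + 1)]
  simp only [_root_.add_apply, ContinuousLinearMap.comp_apply,
    ContinuousLinearMap.flip_apply, ContinuousAlternatingMap.add_apply, smul_add,
    Finset.sum_add_distrib]
  -- The `DV` part of `d (ι_V α)` is the slotwise sum in the Lie derivative.
  have h3 : ∀ i : Fin (k + 1), (-1 : ℤ) ^ (i : ℕ) • (α u).curryLeft (fderivWithin ℝ V s u (v i))
      (i.removeNth v) = α u (Function.update (fun j => ContinuousLinearMap.id ℝ E (v j)) i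
        (fderivWithin ℝ V s u (v i))) := fun i => by
    rw [ContinuousAlternatingMap.curryLeft_apply_apply, neg_one_pow_smul_map_cons_removeNth]
    rfl
  rw [Finset.sum_congr rfl fun i _ => h3 i]
  -- In `ι_V dα` the vector `V` occupies index `0`, which shifts all other indices by one. These
  -- terms therefore cancel the `Dα` part of `d (ι_V α)`, and only the index `0` term `Dα · V`
  -- survives.
  have h4 : ∀ i : Fin (k + 1), (-1 : ℤ) ^ (i.succ : ℕ) • fderivWithin ℝ α s u
      ((Matrix.vecCons (V u) v : Fin (k + 2) → E) i.succ) (i.succ.removeNth (Matrix.vecCons (V u) v))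
      = - ((-1 : ℤ) ^ (i : ℕ) • (ContinuousAlternatingMap.curryLeft (fderivWithin ℝ α s u (v i))) (V u)
        (i.removeNth v)) := fun i => by
    rw [ContinuousAlternatingMap.curryLeft_apply_apply, Fin.val_succ, pow_succ, mul_neg_one,
      neg_smul, Matrix.cons_val_succ]
    congr 3
    funext j
    refine Fin.cases ?_ (fun j => ?_) j <;> simp [Fin.removeNth]
  rw [Finset.sum_congr rfl fun i _ => h4 i, Finset.sum_neg_distrib]
  simp only [Fin.val_zero, pow_zero, one_smul, Matrix.cons_val_zero]
  have h5 : (0 : Fin (k + 2)).removeNth (Matrix.vecCons (V u) v) = v := rfl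
  rw [h5]
  change _ + ∑ i : Fin (k + 1), (-1 : ℤ) ^ (i : ℕ) •
    ContinuousAlternatingMap.curryLeft (fderivWithin ℝ α s u (v i)) (V u) (i.removeNth v) + _ = _
  ring

/-- In degree `0` there are no slots, so the term with `A` is an empty sum and `A` can be arbitrary.
This case serves the boundary statement for `n = 0`. -/
lemma lie_formula_extDerivWithin_zero {α : E → E [⋀^Fin 0]→L[ℝ] ℝ} 
    {s : Set E} {u w : E} (A : E →L[ℝ] E) :
    (extDerivWithin α s u).curryLeft w =
      fderivWithin ℝ α s u w + (α u).fderivCompContinuousLinearMap (ContinuousLinearMap.id ℝ E) A := by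
  ext v
  simp only [ContinuousAlternatingMap.add_apply,
    fderivCompContinuousLinearMap_apply_eq_sum_update,
    ContinuousAlternatingMap.curryLeft_apply_apply, extDerivWithin,
    ContinuousAlternatingMap.alternatizeUncurryFin_apply]
  simp

end VectorSpace

/-! ### Smooth evaluation of alternating maps on varying vectors. -/

section ContDiff

variable {E : Type*} [NormedAddCommGroup E] [NormedSpace ℝ E]
  {F : Type*} [NormedAddCommGroup F] [NormedSpace ℝ F] {r : WithTop ℕ∞} {s : Set F}

lemma ContDiffOn.curryLeft {k : ℕ} {α : F → E [⋀^Fin (k + 1)]→L[ℝ] ℝ} (hα : ContDiffOn ℝ r α s) :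
    ContDiffOn ℝ r (fun y => (α y).curryLeft) s := by
  let C : (E [⋀^Fin (k + 1)]→L[ℝ] ℝ) →L[ℝ] E →L[ℝ] E [⋀^Fin k]→L[ℝ] ℝ :=
    ContinuousAlternatingMap.curryLeftLI.toContinuousLinearMap
  have h : ContDiff ℝ r (fun a => C a) := by fun_prop
  exact h.comp_contDiffOn hα

/-- Currying off one argument at a time reduces this to smoothness of the pairing of a linear map
with a vector. -/
lemma ContDiffOn.continuousAlternatingMap_apply {k : ℕ} {α : F → E [⋀^Fin k]→L[ℝ] ℝ}
    {v : Fin k → F → E} (hα : ContDiffOn ℝ r α s) (hv : ∀ i, ContDiffOn ℝ r (v i) s) :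
    ContDiffOn ℝ r (fun y => α y (fun i => v i y)) s := by
  induction k with
  | zero =>
    have h : ContDiff ℝ r (fun a : E [⋀^Fin 0]→L[ℝ] ℝ =>
        ContinuousAlternatingMap.apply ℝ E ℝ ![] a) := by fun_prop
    refine (h.comp_contDiffOn hα).congr fun y _ => ?_
    exact congrArg (α y) (Subsingleton.elim _ _)
  | succ k ih =>
    refine (ih (hα.curryLeft.clm_apply (hv 0)) fun i => hv i.succ).congr fun y _ => ?_
    rw [ContinuousAlternatingMap.curryLeft_apply_apply]
    refine congrArg (α y) (funext fun i => ?_)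
    refine Fin.cases ?_ (fun i => ?_) i <;> rfl

end ContDiff

/-! ### Chart representatives and Cartan's formula on manifolds with boundary. -/

section Manifold

variable {E : Type*} [NormedAddCommGroup E] [NormedSpace ℝ E]
  {H : Type*} [TopologicalSpace H] {I : ModelWithCorners ℝ E H}
  {M : Type*} [TopologicalSpace M] [ChartedSpace H M] [IsManifold I ∞ M]
  {E' : Type*} [NormedAddCommGroup E'] [NormedSpace ℝ E']
  {H' : Type*} [TopologicalSpace H'] {I' : ModelWithCorners ℝ E' H'}
  {M' : Type*} [TopologicalSpace M'] [ChartedSpace H' M'] [IsManifold I' ∞ M'] {k l : ℕ}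

/-- The vector field `V` read in the preferred chart at `x₀`. -/
noncomputable def VField.inChart (V : VField I M) (x₀ : M) : E → E :=
  VectorField.mpullbackWithin 𝓘(ℝ, E) I (extChartAt I x₀).symm V (range I)

lemma VField.contDiffOn_inChart [CompleteSpace E] {V : VField I M} (hV : IsSmoothVectorField V)
    (x₀ : M) : ContDiffOn ℝ ∞ (VField.inChart V x₀) (extChartAt I x₀).target := by
  have : IsManifold I 1 M := IsManifold.of_le (n := ∞) (by simp)
  intro u hu
  refine contMDiffWithinAt_vectorSpace_iff_contDiffWithinAt.1 ?_
  refine ContMDiffWithinAt.mpullbackWithin_vectorField' (t := univ) (n := ∞)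
    (hV _).contMDiffWithinAt ?_ (isInvertible_mfderivWithin_extChartAt_symm hu) hu ?_ (by simp)
    (by simp) (extChartAt_target_subset_range x₀)
  · exact contMDiffWithinAt_extChartAt_symm_range x₀ hu
  · exact (uniqueDiffOn_extChartAt_target x₀).uniqueMDiffOn

lemma VField.mfderivWithin_inChart [IsManifold I 1 M] (V : VField I M) {x₀ : M} {u : E}
    (hu : u ∈ (extChartAt I x₀).target) :
    mfderivWithin 𝓘(ℝ, E) I (extChartAt I x₀).symm (range I) u (VField.inChart (E := E) V x₀ u) =
      V ((extChartAt I x₀).symm u) := by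
  obtain ⟨e, he⟩ := isInvertible_mfderivWithin_extChartAt_symm (I := I) hu
  rw [VField.inChart, VectorField.mpullbackWithin_apply, ← he, ContinuousLinearMap.inverse_equiv]
  exact e.apply_symm_apply _

lemma VField.mfderiv_extChartAt_self_apply [IsManifold I 1 M] (V : VField I M) (x : M) :
    mfderiv I 𝓘(ℝ, E) (extChartAt I x) x (V x) = VField.inChart V x (extChartAt I x x) := by
  have hu := mem_extChartAt_target (I := I) x
  have h := congrArg (mfderiv I 𝓘(ℝ, E) (extChartAt I x) ((extChartAt I x).symm (extChartAt I x x)))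
    (VField.mfderivWithin_inChart V hu)
  have h' := h.symm.trans (DFunLike.congr_fun
    (mfderiv_extChartAt_comp_mfderivWithin_extChartAt_symm hu) (VField.inChart (E := E) V x (extChartAt I x x)))
  rw [extChartAt_to_inv] at h'
  exact h'

namespace DForm

/-- The representative of `V` is pushed back to `V` by the inverse chart, so contraction may be
carried out before or after passing to coordinates. -/
lemma inChart_contract [IsManifold I 1 M] (V : VField I M) (α : DForm I M (k + 1)) {x₀ : M} {u : E}
    (hu : u ∈ (extChartAt I x₀).target) :
    (contract V α).inChart x₀ u = (α.inChart x₀ u).curryLeft (VField.inChart V x₀ u) := by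
  ext v
  refine congrArg (α ((extChartAt I x₀).symm u)) (funext fun i => ?_)
  refine Fin.cases ?_ (fun i => ?_) i
  · exact (VField.mfderivWithin_inChart V hu).symm
  · rfl

lemma IsSmooth.contract [CompleteSpace E] {V : VField I M} (hV : IsSmoothVectorField V)
    {α : DForm I M (k + 1)} (hα : α.IsSmooth) : (DForm.contract V α).IsSmooth := by
  have : IsManifold I 1 M := IsManifold.of_le (n := ∞) (by simp)
  intro x₀
  exact ((hα x₀).curryLeft.clm_apply (VField.contDiffOn_inChart hV x₀)).congr
    fun u hu => inChart_contract V α hu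

lemma IsSmooth.neg {α : DForm I M k} (hα : α.IsSmooth) : (-α).IsSmooth := fun x₀ =>
  (hα x₀).neg.congr fun u _ => by ext v; rfl

lemma extD_neg (α : DForm I M k) : (-α).extD = -α.extD := by
  have h (x : M) : (-α).inChart x = -(α.inChart x) := by ext u v; rfl
  funext x
  ext v
  have h' : extDerivWithin (-(α.inChart x)) (range I) (extChartAt I x x) =
      -extDerivWithin (α.inChart x) (range I) (extChartAt I x x) := by
    have := extDerivWithin_smul (-1 : ℝ) (α.inChart x) (I.uniqueDiffOn _ (mem_range_self (chartAt H x x)))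
    simpa using this
  rw [extD, h, h']
  rfl

lemma differentiableWithinAt_inChart {α : DForm I M k} (hα : α.IsSmooth) (x : M) :
    DifferentiableWithinAt ℝ (α.inChart x) (range I) (extChartAt I x x) :=
  ((hα x _ (mem_extChartAt_target x)).differentiableWithinAt (by simp)).mono_of_mem_nhdsWithin
    (extChartAt_target_mem_nhdsWithin x)

lemma uniqueDiffWithinAt_range (x : M) :
    UniqueDiffWithinAt ℝ (range I) (extChartAt I x x) :=
  I.uniqueDiffOn _ (mem_range_self _)

/-- Cartan's formula `£_V α = d (ι_V α) + ι_V dα`. -/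
lemma lieD_eq_extD_contract_add [CompleteSpace E] {V : VField I M} (hV : IsSmoothVectorField V)
    {α : DForm I M (k + 1)} (hα : α.IsSmooth) :
    lieD V α = (contract V α).extD + contract V α.extD := by
  have : IsManifold I 1 M := IsManifold.of_le (n := ∞) (by simp)
  funext x
  have hmem := mem_extChartAt_target (I := I) x
  have hV' : DifferentiableWithinAt ℝ (VField.inChart V x) (range I) (extChartAt I x x) :=
    ((VField.contDiffOn_inChart hV x _ hmem).differentiableWithinAt
      (by simp)).mono_of_mem_nhdsWithin (extChartAt_target_mem_nhdsWithin x)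
  have h := cartan_formula_extDerivWithin (differentiableWithinAt_inChart hα x) hV'
    (uniqueDiffWithinAt_range x)
  -- The two representatives agree on the chart target only, which is a neighbourhood within `range
  -- I`; this suffices for derivatives at the point.
  have h1 : extDerivWithin ((contract V α).inChart x) (range I) (extChartAt I x x) =
      extDerivWithin (fun y => (α.inChart x y).curryLeft (VField.inChart V x y)) (range I)
        (extChartAt I x x) := by
    refine EventuallyEq.extDerivWithin_eq ?_ (inChart_contract V α hmem)
    filter_upwards [extChartAt_target_mem_nhdsWithin (I := I) x] with u hu
    exact inChart_contract V α hu
  rw [← h1] at h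
  ext v
  refine (DFunLike.congr_fun h.symm
    (fun i => mfderiv I 𝓘(ℝ, E) (extChartAt I x) x (v i))).trans ?_
  refine congrArg₂ (fun a b : ℝ => a + b) rfl ?_
  refine congrArg (extDerivWithin (α.inChart x) (range I) (extChartAt I x x)) (funext fun i => ?_)
  refine Fin.cases ?_ (fun i => ?_) i
  · exact (VField.mfderiv_extChartAt_self_apply V x).symm
  · rfl

/-- On functions, `£_V f = df (V)`. -/
lemma lieD_eq_contract_extD [CompleteSpace E] (V : VField I M) (α : DForm I M 0) :
    lieD V α = contract V α.extD := by
  have : IsManifold I 1 M := IsManifold.of_le (n := ∞) (by simp)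
  funext x
  have h := lie_formula_extDerivWithin_zero (α := α.inChart x) (s := range I)
    (u := extChartAt I x x) (w := VField.inChart V x (extChartAt I x x))
    (fderivWithin ℝ (VField.inChart V x) (range I) (extChartAt I x x))
  ext v
  refine (DFunLike.congr_fun h.symm
    (fun i => mfderiv I 𝓘(ℝ, E) (extChartAt I x) x (v i))).trans ?_
  refine congrArg (extDerivWithin (α.inChart x) (range I) (extChartAt I x x)) (funext fun i => ?_)
  refine Fin.cases ?_ (fun i => ?_) i
  · exact (VField.mfderiv_extChartAt_self_apply V x).symm
  · exact i.elim0

end DForm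

end Manifold

/-! ### Pullback of exterior derivatives and wedge products that vanish along a map. -/

section Naturality

variable {E : Type*} [NormedAddCommGroup E] [NormedSpace ℝ E]
  {E' : Type*} [NormedAddCommGroup E'] [NormedSpace ℝ E']
  {H' : Type*} [TopologicalSpace H'] {I' : ModelWithCorners ℝ E' H'}
  {M' : Type*} [TopologicalSpace M'] [ChartedSpace H' M'] [IsManifold I' ∞ M'] {k l : ℕ}

lemma fderivWithin_extChartAt_comp [IsManifold I' 1 M'] {g : E → M'} {s : Set E} {u : E} {x₀ : M'}
    (hs : UniqueDiffWithinAt ℝ s u) (hg : MDifferentiableWithinAt 𝓘(ℝ, E) I' g s u)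
    (hx : g u ∈ (extChartAt I' x₀).source) (v : E) :
    fderivWithin ℝ (extChartAt I' x₀ ∘ g) s u v =
      mfderiv I' 𝓘(ℝ, E') (extChartAt I' x₀) (g u) (mfderivWithin 𝓘(ℝ, E) I' g s u v) := by
  rw [extChartAt_source] at hx
  rw [← mfderivWithin_eq_fderivWithin,
    mfderiv_comp_mfderivWithin u (mdifferentiableAt_extChartAt hx) hg hs.uniqueMDiffWithinAt]
  rfl

lemma mfderivWithin_extChartAt_symm_fderivWithin [IsManifold I' 1 M'] {g : E → M'} {s : Set E}
    {u : E} {x₀ : M'}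
    (hs : UniqueDiffWithinAt ℝ s u) (hg : MDifferentiableWithinAt 𝓘(ℝ, E) I' g s u)
    (hx : g u ∈ (extChartAt I' x₀).source) (v : E) :
    mfderivWithin 𝓘(ℝ, E') I' (extChartAt I' x₀).symm (range I') (extChartAt I' x₀ (g u))
      (fderivWithin ℝ (extChartAt I' x₀ ∘ g) s u v) = mfderivWithin 𝓘(ℝ, E) I' g s u v := by
  rw [fderivWithin_extChartAt_comp hs hg hx]
  exact DFunLike.congr_fun (mfderivWithin_extChartAt_symm_comp_mfderiv_extChartAt' hx) _

namespace DForm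

/-- If a form pulls back to zero along `g`, then so does its exterior derivative. -/
lemma extD_comp_mfderivWithin_eq_zero {α : DForm I' M' k} (hα : α.IsSmooth) {g : E → M'} {s : Set E}
    {u : E} (hs : UniqueDiffOn ℝ s) (hu : u ∈ s) (hu' : u ∈ closure (interior s))
    (hg : ContMDiffWithinAt 𝓘(ℝ, E) I' ∞ g s u)
    (h0 : ∀ᶠ w in 𝓝[s] u, ∀ v : Fin k → E,
      α (g w) (fun i => mfderivWithin 𝓘(ℝ, E) I' g s w (v i)) = 0) (v : Fin (k + 1) → E) :
    α.extD (g u) (fun i => mfderivWithin 𝓘(ℝ, E) I' g s u (v i)) = 0 := by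
  have : IsManifold I' 1 M' := IsManifold.of_le (n := ∞) (by simp)
  set G : E → E' := extChartAt I' (g u) ∘ g with hG
  have hsrc := mem_extChartAt_source (I := I') (g u)
  have hGs : ContDiffWithinAt ℝ ∞ G s u := by
    have := (contMDiffAt_extChartAt (I := I') (n := ∞) (x := g u)).comp_contMDiffWithinAt u hg
    exact this.contDiffWithinAt
  have hmaps : MapsTo G s (range I') := fun w _ => mem_range_self _
  have hdiff : DifferentiableWithinAt ℝ (α.inChart (g u)) (range I') (G u) :=
    differentiableWithinAt_inChart hα (g u)
  -- Naturality of `d` rests on the symmetry of the second derivative of `G`; within a set this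
  -- requires `u` to be a limit of interior points, whence `hu'`.
  have hpull := extDerivWithin_pullback hdiff hGs
    (by simpa using (ENat.LEInfty.out : (2 : WithTop ℕ∞) ≤ ∞)) hs hu' hu hmaps
  have hz : (fun w => (α.inChart (g u) (G w)).compContinuousLinearMap (fderivWithin ℝ G s w))
      =ᶠ[𝓝[s] u] fun _ => 0 := by
    have h1 : ∀ᶠ w in 𝓝[s] u, MDifferentiableWithinAt 𝓘(ℝ, E) I' g s w := by
      have := (contMDiffWithinAt_iff_contMDiffWithinAt_nhdsWithin (n := 1) (by simp)).1
        (hg.of_le (by simp))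
      rw [insert_eq_of_mem hu] at this
      filter_upwards [this] with w hw
      exact hw.mdifferentiableWithinAt (by simp)
    have h2 : ∀ᶠ w in 𝓝[s] u, g w ∈ (extChartAt I' (g u)).source :=
      hg.continuousWithinAt (extChartAt_source_mem_nhds (I := I') (g u))
    filter_upwards [h0, h1, h2, self_mem_nhdsWithin] with w hw0 hw1 hw2 hws
    ext v
    -- The base points `y` and `g w` are only propositionally equal, but all tangent spaces are the
    -- same model space, so the same vectors can be inserted at both. The same device recurs below.
    have h3 : ∀ y, y = g w → ∀ V : Fin k → E', α y V = α (g w) V := by rintro _ rfl _; rfl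
    refine Eq.trans ?_ (hw0 v)
    refine (h3 _ ((extChartAt I' (g u)).left_inv hw2) _).trans ?_
    refine congrArg (α (g w)) (funext fun i => ?_)
    exact mfderivWithin_extChartAt_symm_fderivWithin (hs w hws) hw1 hw2 (v i)
  have hd : extDerivWithin (fun w => (α.inChart (g u) (G w)).compContinuousLinearMap
      (fderivWithin ℝ G s w)) s u = 0 := by
    rw [hz.extDerivWithin_eq_of_mem hu]
    ext v
    simp [extDerivWithin, ContinuousAlternatingMap.alternatizeUncurryFin_apply]
  rw [hpull] at hd
  refine Eq.trans ?_ (DFunLike.congr_fun hd v)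
  refine congrArg (extDerivWithin (α.inChart (g u)) (range I') (extChartAt I' (g u) (g u)))
    (funext fun i => ?_)
  exact (fderivWithin_extChartAt_comp (hs u hu) (hg.mdifferentiableWithinAt (by simp)) hsrc _).symm

end DForm

/-- Every summand of the alternatization has a factor `β` evaluated on vectors in the image of `A`.
-/
lemma wedgeForms_comp_eq_zero {k l : ℕ} (α : E' [⋀^Fin k]→L[ℝ] ℝ) (β : E' [⋀^Fin l]→L[ℝ] ℝ)
    (A : E →L[ℝ] E') (h : β.compContinuousLinearMap A = 0) :
    (wedgeForms α β).compContinuousLinearMap A = 0 := by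
  ext v
  simp only [wedgeForms, ContinuousAlternatingMap.compContinuousLinearMap_apply,
    ContinuousAlternatingMap.smul_apply, ContinuousMultilinearMap.alternatization_apply_apply]
  rw [Finset.sum_eq_zero, smul_zero]
  · rfl
  intro σ _
  have h1 : β ((fun i => A (v (σ i))) ∘ Fin.natAdd k) = 0 := 
    DFunLike.congr_fun h ((fun i => v (σ i)) ∘ Fin.natAdd k)
  change _ • (_ * β ((fun i => A (v (σ i))) ∘ Fin.natAdd k)) = _
  rw [h1, mul_zero, smul_zero]

end Naturality

/-! ### The Poincaré-Cartan form in coordinates. -/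

noncomputable section LocalForm

variable {n m : ℕ}

/-- The model space of the jet bundle. -/
abbrev JetSpace (n m : ℕ) := (BaseSpace n × FibreSpace m) × (BaseSpace n →L[ℝ] FibreSpace m)

/-- The volume form `dx^0 ∧ … ∧ dx^n`. -/
def volForm (n : ℕ) : BaseSpace n [⋀^Fin (n + 1)]→L[ℝ] ℝ :=
  { (EuclideanSpace.basisFun (Fin (n + 1)) ℝ).toBasis.det with
    cont := by
      change Continuous fun v : Fin (n + 1) → BaseSpace n =>
        (EuclideanSpace.basisFun (Fin (n + 1)) ℝ).toBasis.det v
      simp only [Module.Basis.det_apply]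
      refine Continuous.matrix_det (continuous_matrix fun i j => ?_)
      simp only [Module.Basis.toMatrix_apply]
      simp
      fun_prop }

lemma volForm_coordVec : volForm n coordVec = 1 := by
  have := (EuclideanSpace.basisFun (Fin (n + 1)) ℝ).toBasis.det_self
  refine Eq.trans ?_ this
  refine congrArg (volForm n) (funext fun i => ?_)
  simp

lemma eq_smul_volForm (α : BaseSpace n [⋀^Fin (n + 1)]→L[ℝ] ℝ) : α = α coordVec • volForm n := by
  have := α.toAlternatingMap.eq_smul_basis_det (EuclideanSpace.basisFun (Fin (n + 1)) ℝ).toBasis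
  ext v
  refine (DFunLike.congr_fun this v).trans ?_
  have h : ((EuclideanSpace.basisFun (Fin (n + 1)) ℝ).toBasis : Fin (n + 1) → BaseSpace n) =
      coordVec := funext fun i => by simp
  rw [h]
  rfl

lemma baseSpace_eq_sum (a : BaseSpace n) : a = ∑ i, a i • coordVec i := by
  ext j
  simp [Pi.single_apply]

/-- Expand `a` in the coordinate basis: every component except the `i`-th repeats a vector already
present. -/
lemma volForm_update_coordVec (i : Fin (n + 1)) (a : BaseSpace n) :
    volForm n (Function.update coordVec i a) = a i := by
  conv_lhs => rw [baseSpace_eq_sum a]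
  rw [show volForm n (Function.update coordVec i (∑ j, a j • coordVec j)) =
    ∑ j, volForm n (Function.update coordVec i (a j • coordVec j)) from
      (volForm n).toAlternatingMap.map_update_sum Finset.univ i _ _, Finset.sum_eq_single i]
  · rw [ContinuousAlternatingMap.map_update_smul, Function.update_eq_self, volForm_coordVec]
    simp
  · intro j _ hj
    rw [ContinuousAlternatingMap.map_update_smul,
      (volForm n).map_eq_zero_of_eq (i := i) (j := j) _ (by simp [hj]) hj.symm, smul_zero]
  · simp

/-- The vertical vector `w^i ∂/∂z^i_ν`. -/
def vertVec (n m : ℕ) (ν : Fin (n + 1)) : FibreSpace m →L[ℝ] JetSpace n m :=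
  (ContinuousLinearMap.inr ℝ (BaseSpace n × FibreSpace m) (BaseSpace n →L[ℝ] FibreSpace m)).comp
    (ContinuousLinearMap.smulRightL ℝ (BaseSpace n) (FibreSpace m) (coordCovec ν))

lemma vertVec_apply (ν : Fin (n + 1)) (w : FibreSpace m) :
    vertVec n m ν w = ((0, 0), (coordCovec ν).smulRight w) := rfl

lemma vertVec_eq_inr (ν : Fin (n + 1)) (w : FibreSpace m) : vertVec n m ν w =
    ContinuousLinearMap.inr ℝ (BaseSpace n × FibreSpace m) (BaseSpace n →L[ℝ] FibreSpace m)
      ((coordCovec ν).smulRight w) := rfl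

lemma sum_vertVec (B : BaseSpace n →L[ℝ] FibreSpace m) :
    ∑ ν, vertVec n m ν (B (coordVec ν)) = ((0, 0), B) := by
  have h : ∑ ν, ContinuousLinearMap.smulRight (coordCovec ν) (B (coordVec ν)) = B := by
    ext v : 1
    conv_rhs => rw [baseSpace_eq_sum v]
    simp
  simp only [vertVec_eq_inr]
  rw [← map_sum, h]
  rfl

/-- The momenta `∂Λ/∂z^i_ν`, as a map from the fibre to the base. -/
def momentumMap (n m : ℕ) : (JetSpace n m →L[ℝ] ℝ) →L[ℝ] FibreSpace m →L[ℝ] BaseSpace n :=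
  ∑ ν, ((ContinuousLinearMap.smulRightL ℝ (FibreSpace m) (BaseSpace n)).flip (coordVec ν)).comp
    ((ContinuousLinearMap.compL ℝ (FibreSpace m) (JetSpace n m) ℝ).flip (vertVec n m ν))

lemma momentumMap_apply (ℓ : JetSpace n m →L[ℝ] ℝ) (w : FibreSpace m) :
    momentumMap n m ℓ w = ∑ ν, ℓ (vertVec n m ν w) • coordVec ν := by
  simp [momentumMap]

lemma momentumMap_apply_coord (ℓ : JetSpace n m →L[ℝ] ℝ) (w : FibreSpace m) (i : Fin (n + 1)) :
    momentumMap n m ℓ w i = ℓ (vertVec n m i w) := by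
  simp [momentumMap_apply, Pi.single_apply]

/-- The projection of the jet model space onto the base. -/
abbrev jetFst (n m : ℕ) : JetSpace n m →L[ℝ] BaseSpace n :=
  (ContinuousLinearMap.fst ℝ (BaseSpace n) (FibreSpace m)).comp
    (ContinuousLinearMap.fst ℝ _ (BaseSpace n →L[ℝ] FibreSpace m))

/-- The contact forms `θ^i = dy^i - z^i_μ dx^μ` at a jet with linear part `B`. -/
def contactMap (B : BaseSpace n →L[ℝ] FibreSpace m) : JetSpace n m →L[ℝ] FibreSpace m :=
  (ContinuousLinearMap.snd ℝ (BaseSpace n) (FibreSpace m)).comp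
    (ContinuousLinearMap.fst ℝ _ (BaseSpace n →L[ℝ] FibreSpace m)) - B.comp (jetFst n m)

/-- The Poincaré-Cartan form of the Lagrangian density `Λ`, in coordinates; the derivatives of
`Λ` are taken within `s`. -/
def localCartan (Λ : JetSpace n m → ℝ) (s : Set (JetSpace n m)) (q : JetSpace n m) :
    JetSpace n m [⋀^Fin (n + 1)]→L[ℝ] ℝ :=
  Λ q • (volForm n).compContinuousLinearMap (jetFst n m) +
    (volForm n).fderivCompContinuousLinearMap (jetFst n m)
      ((momentumMap n m (fderivWithin ℝ Λ s q)).comp (contactMap q.2))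

lemma contDiff_contactMap : ContDiff ℝ ∞ (contactMap : _ → JetSpace n m →L[ℝ] FibreSpace m) := by
  unfold contactMap
  fun_prop

/-- `localCartan` has this shape: `fderivCompContinuousLinearMap` is linear in its second argument,
so smoothness reduces to that of `Λ` and of the momenta composed with the contact forms. -/
lemma ContDiffOn.smul_const_add_clm {V W G : Type*} [NormedAddCommGroup V] [NormedSpace ℝ V]
    [NormedAddCommGroup W] [NormedSpace ℝ W] [NormedAddCommGroup G] [NormedSpace ℝ G]
    {r : WithTop ℕ∞} {t : Set V} {f : V → ℝ} {h : V → G} (hf : ContDiffOn ℝ r f t)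
    (hh : ContDiffOn ℝ r h t) (c : W) (A : G →L[ℝ] W) :
    ContDiffOn ℝ r (fun q => f q • c + A (h q)) t :=
  (hf.smul contDiffOn_const).add (A.contDiff.comp_contDiffOn hh)

lemma contDiffOn_localCartan {Λ : JetSpace n m → ℝ} {s t : Set (JetSpace n m)}
    (hΛ : ContDiffOn ℝ ∞ Λ t) (hΛ' : ContDiffOn ℝ ∞ (fderivWithin ℝ Λ s) t) :
    ContDiffOn ℝ ∞ (localCartan Λ s) t := by
  have h1 : ContDiffOn ℝ ∞ (fun q => (momentumMap n m (fderivWithin ℝ Λ s q)).comp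
      (contactMap q.2)) t := by
    refine ContDiffOn.clm_comp ?_ ?_
    · exact (momentumMap n m).contDiff.comp_contDiffOn hΛ'
    · exact (contDiff_contactMap.comp contDiff_snd).contDiffOn
  exact hΛ.smul_const_add_clm h1 _ _

end LocalForm

/-! ### Derivatives of evaluated covector fields. -/

section Calculus

variable {V W : Type*} [NormedAddCommGroup V] [NormedSpace ℝ V] [NormedAddCommGroup W]
  [NormedSpace ℝ W] {ℓ : V → V →L[ℝ] ℝ} {s : Set V} {t : Set W} {σ : W → V} {σ' : W →L[ℝ] V} {u : W}

/-- The factor `T x - T q` vanishes at `q = x`, so the derivative of `ℓ` drops out. Applied with `ℓ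
= DΛ`, this removes the second derivatives of `Λ` from the horizontal term. -/
lemma fderivWithin_add_clm_sub_apply {f : V → ℝ} {x : V} (hs : UniqueDiffWithinAt ℝ s x)
    (hf : DifferentiableWithinAt ℝ f s x) (hℓ : DifferentiableWithinAt ℝ ℓ s x) (T : V →L[ℝ] V)
    (v : V) : fderivWithin ℝ (fun q => f q + ℓ q (T x - T q)) s x v =
      fderivWithin ℝ f s x v - ℓ x (T v) := by
  have h2 : HasFDerivWithinAt (fun q => T x - T q) (-T) s x := T.hasFDerivWithinAt.const_sub _
  have h3 : HasFDerivWithinAt (fun q => f q + ℓ q (T x - T q)) _ s x :=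
    hf.hasFDerivWithinAt.add (hℓ.hasFDerivWithinAt.clm_apply h2)
  rw [h3.fderivWithin hs]
  simp [sub_eq_add_neg]

lemma fderivWithin_zsmul_clm_apply {x : V} (hs : UniqueDiffWithinAt ℝ s x)
    (hℓ : DifferentiableWithinAt ℝ ℓ s x) (c : ℤ) (a v : V) :
    fderivWithin ℝ (fun q => c • ℓ q a) s x v = c • fderivWithin ℝ ℓ s x v a := by
  have h2 := hℓ.hasFDerivWithinAt.clm_apply (hasFDerivWithinAt_const a x s)
  have h3 : HasFDerivWithinAt (fun q => c • ℓ q a) _ s x := h2.const_smul c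
  rw [h3.fderivWithin hs]
  simp

lemma fderivWithin_clm_apply_comp (ht : UniqueDiffWithinAt ℝ t u)
    (hℓ : DifferentiableWithinAt ℝ ℓ s (σ u)) (hσ : HasFDerivWithinAt σ σ' t u)
    (hmaps : MapsTo σ t s) (a : V) (v : W) :
    fderivWithin ℝ (fun u' => ℓ (σ u') a) t u v = fderivWithin ℝ ℓ s (σ u) (σ' v) a := by
  have h2 := hℓ.hasFDerivWithinAt.clm_apply (hasFDerivWithinAt_const a (σ u) s)
  have h3 : HasFDerivWithinAt (fun u' => ℓ (σ u') a) _ t u := h2.comp u hσ hmaps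
  rw [h3.fderivWithin ht]
  simp

end Calculus

/-! ### The exterior derivative of the local form and the Euler-Lagrange expression. -/

section LocalEulerLagrange

variable {n m : ℕ} {Λ : JetSpace n m → ℝ} {s : Set (JetSpace n m)}

lemma localCartan_apply (q : JetSpace n m) (V : Fin (n + 1) → JetSpace n m) :
    localCartan Λ s q V = Λ q * volForm n (fun j => (V j).1.1) +
      ∑ i, volForm n (Function.update (fun j => (V j).1.1) i
        (momentumMap n m (fderivWithin ℝ Λ s q) ((V i).1.2 - q.2 (V i).1.1))) := by
  refine congrArg₂ (fun a b : ℝ => a + b) rfl ?_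
  exact fderivCompContinuousLinearMap_apply_eq_sum_update _ _ _ _

/-- The base components form the standard frame, so replacing slot `i` by the momentum vector reads
off its `i`-th coordinate. The contact forms measure the difference between the slope `B` of the
frame and the slope `q.2` of the jet. -/
lemma localCartan_apply_horizontal (q : JetSpace n m) {V : Fin (n + 1) → JetSpace n m}
    {B : BaseSpace n →L[ℝ] FibreSpace m} (hV : ∀ i, (V i).1 = (coordVec i, B (coordVec i))) :
    localCartan Λ s q V = Λ q + fderivWithin ℝ Λ s q ((0, 0), B - q.2) := by
  have h0 : (fun j => (V j).1.1) = coordVec := funext fun j => by rw [hV]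
  rw [localCartan_apply, h0, volForm_coordVec, mul_one, ← sum_vertVec, map_sum]
  refine congrArg₂ (fun a b : ℝ => a + b) rfl (Finset.sum_congr rfl fun i _ => ?_)
  rw [volForm_update_coordVec, momentumMap_apply_coord, hV]
  rfl

/-- The first vector has base component zero, so every term in which slot `0` is kept vanishes. Only
the replacement of slot `0` survives, and moving the momentum vector into the gap at `i` gives the
sign. -/
lemma localCartan_apply_vertical (q : JetSpace n m) {V : Fin (n + 1) → JetSpace n m}
    (hV : ∀ i, (V i).1.1 = coordVec i) (i : Fin (n + 1)) (w : FibreSpace m)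
    (B : BaseSpace n →L[ℝ] FibreSpace m) :
    localCartan Λ s q (Matrix.vecCons ((0, w), B) (i.removeNth V)) =
      (-1 : ℤ) ^ (i : ℕ) • fderivWithin ℝ Λ s q (vertVec n m i w) := by
  have h0 : (fun j => ((Matrix.vecCons ((0, w), B) (i.removeNth V) :
      Fin (n + 1) → JetSpace n m) j).1.1) = Matrix.vecCons 0 (i.removeNth coordVec) := by
    funext j
    refine Fin.cases rfl (fun j => ?_) j
    simp [Fin.removeNth, hV]
  rw [localCartan_apply, h0, (volForm n).map_coord_zero 0 (by rfl), mul_zero, zero_add,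
    Finset.sum_eq_single 0]
  · have h1 : ∀ a : BaseSpace n, Function.update (Matrix.vecCons 0 (i.removeNth coordVec)) 0 a =
        (Matrix.vecCons a (i.removeNth coordVec) : Fin (n + 1) → BaseSpace n) := fun a => by
      funext j
      refine Fin.cases (by simp) (fun j => by simp) j
    rw [h1, ← momentumMap_apply_coord, ← volForm_update_coordVec,
      ← neg_one_pow_smul_map_cons_removeNth, smul_smul, ← mul_pow]
    simp
  · intro j _ hj
    exact (volForm n).map_coord_zero 0 (by simp [hj.symm])
  · simp

variable {σ : BaseSpace n → JetSpace n m} {σ' : BaseSpace n →L[ℝ] JetSpace n m}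
  {t : Set (BaseSpace n)} {u : BaseSpace n}

/-- Expand `dΘ` on frozen vectors. Omitting the vertical vector leaves a horizontal frame, on which
`Θ` is `Λ` plus a correction vanishing at `σ u`; its derivative is `∂Λ/∂y`. Omitting `σ' e_μ` leaves
`± ∂Λ/∂z_μ`, whose derivative along `σ' e_μ` is the total derivative along the section. The
component `B` cancels. -/
lemma extDerivWithin_localCartan_vertical (hs : UniqueDiffWithinAt ℝ s (σ u))
    (ht : UniqueDiffWithinAt ℝ t u) (hΛ : DifferentiableWithinAt ℝ Λ s (σ u))
    (hΛ' : DifferentiableWithinAt ℝ (fderivWithin ℝ Λ s) s (σ u))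
    (hΘ : DifferentiableWithinAt ℝ (localCartan Λ s) s (σ u))
    (hσ : HasFDerivWithinAt σ σ' t u) (hmaps : MapsTo σ t s)
    (hσ' : ∀ v, (σ' v).1 = (v, (σ u).2 v)) (w : FibreSpace m)
    (B : BaseSpace n →L[ℝ] FibreSpace m) :
    extDerivWithin (localCartan Λ s) s (σ u)
      (Matrix.vecCons ((0, w), B) (fun ν => σ' (coordVec ν))) =
      fderivWithin ℝ Λ s (σ u) ((0, w), 0) - ∑ μ, fderivWithin ℝ
        (fun u' => fderivWithin ℝ Λ s (σ u') (vertVec n m μ w)) t u (coordVec μ) := by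
  rw [extDerivWithin_apply hΘ hs, Fin.sum_univ_succ (n := n + 1), sub_eq_add_neg,
    ← Finset.sum_neg_distrib]
  refine congrArg₂ (fun a b : ℝ => a + b) ?_ (Finset.sum_congr rfl fun i _ => ?_)
  · have h1 : ∀ q : JetSpace n m, localCartan Λ s q ((0 : Fin (n + 2)).removeNth
        (Matrix.vecCons ((0, w), B) (fun ν => σ' (coordVec ν)))) =
        Λ q + fderivWithin ℝ Λ s q ((0, 0), (σ u).2 - q.2) := fun q =>
      localCartan_apply_horizontal q fun i => hσ' _
    simp only [h1]
    -- `T` keeps only the `z`-coordinates, so that the correction has the form `DΛ (T (σ u) - T q)`.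
    let T : JetSpace n m →L[ℝ] JetSpace n m :=
      (ContinuousLinearMap.inr ℝ (BaseSpace n × FibreSpace m) _).comp
          (ContinuousLinearMap.snd ℝ _ (BaseSpace n →L[ℝ] FibreSpace m))
    have hT : ∀ q : JetSpace n m, ((0, 0), (σ u).2 - q.2) = T (σ u) - T q := fun q => by
      refine Prod.ext ?_ rfl
      exact (sub_self (0 : BaseSpace n × FibreSpace m)).symm
    simp only [hT]
    have h2 := fderivWithin_add_clm_sub_apply hs hΛ hΛ' T ((0, w), B)
    have h4 : ((0, w), B) - T ((0, w), B) = ((0, w), 0) := by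
      refine Prod.ext (sub_zero _) (sub_self B)
    rw [← map_sub, h4] at h2
    rw [← h2]
    exact one_smul _ _
  · have h1 : ∀ q : JetSpace n m, localCartan Λ s q (i.succ.removeNth
        (Matrix.vecCons ((0, w), B) (fun ν => σ' (coordVec ν)))) =
        (-1 : ℤ) ^ (i : ℕ) • fderivWithin ℝ Λ s q (vertVec n m i w) := fun q => by
      rw [← localCartan_apply_vertical q (V := fun ν => σ' (coordVec ν))
        (fun ν => by rw [hσ']) i w B]
      congr 1
      funext j
      refine Fin.cases ?_ (fun j => ?_) j <;> simp [Fin.removeNth]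
    simp only [h1]
    -- The sign `(-1)^(i+1)` from the exterior derivative and `(-1)^i` from the vertical evaluation
    -- combine to `-1` for every `i`.
    rw [fderivWithin_zsmul_clm_apply hs hΛ', fderivWithin_clm_apply_comp ht hΛ' hσ hmaps,
      Matrix.cons_val_succ, Fin.val_succ, pow_succ, mul_neg_one, neg_smul, smul_smul, ← mul_pow,
      neg_one_mul, neg_neg, one_pow, one_smul]

/-- Subtracting from `ξ` the tangent vector of the section with the same base component leaves a
vertical vector, to which the Euler-Lagrange expression applies. -/
lemma extDerivWithin_localCartan_eq_zero (hs : UniqueDiffWithinAt ℝ s (σ u))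
    (ht : UniqueDiffWithinAt ℝ t u) (hΛ : DifferentiableWithinAt ℝ Λ s (σ u))
    (hΛ' : DifferentiableWithinAt ℝ (fderivWithin ℝ Λ s) s (σ u))
    (hΘ : DifferentiableWithinAt ℝ (localCartan Λ s) s (σ u))
    (hσ : HasFDerivWithinAt σ σ' t u) (hmaps : MapsTo σ t s)
    (hσ' : ∀ v, (σ' v).1 = (v, (σ u).2 v))
    (hEL : ∀ i : Fin m, fderivWithin ℝ Λ s (σ u) ((0, EuclideanSpace.single i 1), 0) -
      ∑ μ, fderivWithin ℝ (fun u' => fderivWithin ℝ Λ s (σ u')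
        ((0, 0), (coordCovec μ).smulRight (EuclideanSpace.single i 1))) t u (coordVec μ) = 0)
    (ξ : JetSpace n m) :
    extDerivWithin (localCartan Λ s) s (σ u)
      (Matrix.vecCons ξ (fun ν => σ' (coordVec ν))) = 0 := by
  set α := extDerivWithin (localCartan Λ s) s (σ u) with hα
  set w : FibreSpace m := ξ.1.2 - (σ u).2 ξ.1.1 with hw
  have hξ : ξ = σ' ξ.1.1 + ((0, w), ξ.2 - (σ' ξ.1.1).2) := by
    refine Prod.ext ?_ ?_
    · rw [Prod.fst_add, hσ']
      refine Prod.ext (by simp) (by simp [hw])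
    · simp
  have h0 : α (Matrix.vecCons (σ' ξ.1.1) (fun ν => σ' (coordVec ν))) = 0 := by
    have h1 : α.compContinuousLinearMap σ' (Matrix.vecCons ξ.1.1 coordVec) = 0 := by
      -- These are the images of `n + 2` vectors of an `(n + 1)`-dimensional space.
      refine AlternatingMap.map_linearDependent (K := ℝ)
        (α.compContinuousLinearMap σ').toAlternatingMap _ fun hli => ?_
      have := hli.fintype_card_le_finrank
      simp at this
    refine Eq.trans (congrArg α (funext fun j => ?_)) h1
    refine Fin.cases ?_ (fun j => ?_) j <;> rfl
  have h1 : α (Matrix.vecCons ξ (fun ν => σ' (coordVec ν))) =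
      α (Matrix.vecCons (σ' ξ.1.1) (fun ν => σ' (coordVec ν))) +
      α (Matrix.vecCons ((0, w), ξ.2 - (σ' ξ.1.1).2) (fun ν => σ' (coordVec ν))) := by
    simp only [← ContinuousAlternatingMap.curryLeft_apply_apply]
    rw [← ContinuousAlternatingMap.add_apply, ← map_add, ← hξ]
  rw [h1, h0, zero_add, hα,
    extDerivWithin_localCartan_vertical hs ht hΛ hΛ' hΘ hσ hmaps hσ']
  set C := (fderivWithin ℝ (fderivWithin ℝ Λ s) s (σ u)).comp σ'
  have hC' : ∀ (a : JetSpace n m) (v : BaseSpace n),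
      fderivWithin ℝ (fun u' => fderivWithin ℝ Λ s (σ u') a) t u v = C v a := fun a v =>
    fderivWithin_clm_apply_comp ht hΛ' hσ hmaps a v
  -- The Euler-Lagrange expression is linear in `w`, so its vanishing on the coordinate basis is
  -- enough.
  let Φ : FibreSpace m →ₗ[ℝ] ℝ :=
    (fderivWithin ℝ Λ s (σ u)).toLinearMap ∘ₗ LinearMap.inl ℝ _ _ ∘ₗ LinearMap.inr ℝ _ _ -
      ∑ μ, (C (coordVec μ)).toLinearMap ∘ₗ (vertVec n m μ).toLinearMap
  have hΦ : ∀ w, Φ w = fderivWithin ℝ Λ s (σ u) ((0, w), 0) - ∑ μ, fderivWithin ℝ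
        (fun u' => fderivWithin ℝ Λ s (σ u') (vertVec n m μ w)) t u (coordVec μ) := fun w => by
    simp [Φ, hC']
  rw [← hΦ]
  have : Φ = 0 := by
    refine (EuclideanSpace.basisFun (Fin m) ℝ).toBasis.ext fun i => ?_
    have := hEL i
    simp only [← vertVec_apply] at this
    rw [← hΦ] at this
    simpa using this
  rw [this]
  rfl

end LocalEulerLagrange

/-! ### Tangent maps of the projections and of the vertical lift in jet charts. -/

noncomputable section JetCharts

variable {n m : ℕ} {H : Type*} [TopologicalSpace H] {I : ModelWithCorners ℝ (BaseSpace n) H}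
  {X : Type*} [TopologicalSpace X] [ChartedSpace H X] [IsManifold I ∞ X]
  {Y : Type*} [TopologicalSpace Y] [ChartedSpace (ModelProd H (FibreSpace m)) Y]
  [IsManifold (totalModel I m) ∞ Y]
  {p : Fibration I (FibreSpace m) X Y}

namespace Jet

/-- The model topological space of the jet bundle. -/
abbrev Model (H : Type*) [TopologicalSpace H] (n m : ℕ) :=
  ModelProd (ModelProd H (FibreSpace m)) (BaseSpace n →L[ℝ] FibreSpace m)

lemma chartAt_source (z₀ : Jet p) :
    (chartAt (Model H n m) z₀).source = {z | z.pt ∈ (p.fiberedChartAt z₀.pt).total.source} := rfl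

lemma chartAt_symm_apply (z₀ : Jet p) {h : Model H n m}
    (hh : h ∈ (chartAt (Model H n m) z₀).target) :
    (chartAt (Model H n m) z₀).symm h = (p.fiberedChartAt z₀.pt).ofCoord h.1 hh h.2 :=
  (p.fiberedChartAt z₀.pt).jetChart_symm_apply z₀ hh

/-- A jet chart covers a fibred chart of `Y`, so in coordinates `π_{YZ}` is the first projection
followed by the inverse chart of `Y`. -/
lemma hasMFDerivAt_pt_comp_chartAt_symm (z₀ : Jet p) {h : Model H n m}
    (hh : h ∈ (chartAt (Model H n m) z₀).target) :
    HasMFDerivAt (jetModel I m) (totalModel I m) (Jet.pt ∘ (chartAt (Model H n m) z₀).symm) h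
      (((p.fiberedChartAt z₀.pt).dTotalSymm h.1).comp
        (ContinuousLinearMap.fst ℝ (BaseSpace n × FibreSpace m)
          (BaseSpace n →L[ℝ] FibreSpace m))) := by
  have h1 := hasMFDerivAt_modelProd_fst (totalModel I m) (BaseSpace n →L[ℝ] FibreSpace m) h
  have h2 := ((p.fiberedChartAt z₀.pt).mdiffTotal.mdifferentiableAt_symm hh).hasMFDerivAt
  refine (HasMFDerivAt.comp h h2 h1).congr_of_eventuallyEq ?_
  filter_upwards [(chartAt (Model H n m) z₀).open_target.mem_nhds hh] with h' hh'
  rw [Function.comp_apply, chartAt_symm_apply z₀ hh']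
  rfl

lemma hasMFDerivAt_base_comp_chartAt_symm (z₀ : Jet p) {h : Model H n m}
    (hh : h ∈ (chartAt (Model H n m) z₀).target) :
    HasMFDerivAt (jetModel I m) I (Jet.base ∘ (chartAt (Model H n m) z₀).symm) h
      (((p.fiberedChartAt z₀.pt).dBaseSymm h.1.1).comp (jetFst n m)) := by
  have h1 := hasMFDerivAt_modelProd_fst (totalModel I m) (BaseSpace n →L[ℝ] FibreSpace m) h
  have h2 := hasMFDerivAt_modelProd_fst I (FibreSpace m) h.1
  set κ := p.fiberedChartAt z₀.pt
  have hfst : ∀ h' ∈ (chartAt (Model H n m) z₀).target,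
      h'.1.1 = κ.base (p.proj (κ.total.symm h'.1)) := fun h' hh' => by
    rw [← κ.fst_eq _ (κ.total.map_target hh'), κ.total.right_inv hh']
  have hmem : h.1.1 ∈ κ.base.target := by
    rw [hfst h hh]
    exact κ.base.map_source (κ.mapsTo (κ.total.map_target hh))
  have h3 := (κ.mdiffBase.mdifferentiableAt_symm hmem).hasMFDerivAt
  refine (HasMFDerivAt.comp h h3 (HasMFDerivAt.comp h h2 h1)).congr_of_eventuallyEq ?_
  filter_upwards [(chartAt (Model H n m) z₀).open_target.mem_nhds hh] with h' hh'
  rw [Function.comp_apply, chartAt_symm_apply z₀ hh']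
  change p.proj (κ.total.symm h'.1) = κ.base.symm h'.1.1
  rw [hfst h' hh', κ.base.left_inv (κ.mapsTo (κ.total.map_target hh'))]

lemma mdifferentiable_chartAt (z₀ : Jet p) :
    (chartAt (Model H n m) z₀).MDifferentiable (jetModel I m) (jetModel I m) :=
  have : IsManifold (jetModel I m) 1 (Jet p) := IsManifold.of_le (n := ∞) (by simp)
  mdifferentiable_chart z₀

lemma mdifferentiableAt_of_comp_chartAt_symm {E' H' M' : Type*} [NormedAddCommGroup E']
    [NormedSpace ℝ E'] [TopologicalSpace H'] {I' : ModelWithCorners ℝ E' H'} [TopologicalSpace M']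
    [ChartedSpace H' M'] {f : Jet p → M'} {z₀ z : Jet p} 
    (hz : z ∈ (chartAt (Model H n m) z₀).source)
    (hf : MDifferentiableAt (jetModel I m) I' (f ∘ (chartAt (Model H n m) z₀).symm)
      (chartAt (Model H n m) z₀ z)) : MDifferentiableAt (jetModel I m) I' f z := by
  have h := hf.comp z ((mdifferentiable_chartAt z₀).mdifferentiableAt hz)
  refine h.congr_of_eventuallyEq ?_
  filter_upwards [(chartAt (Model H n m) z₀).open_source.mem_nhds hz] with z' hz'
  simp [hz']

lemma mdifferentiableAt_pt (z : Jet p) :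
    MDifferentiableAt (jetModel I m) (totalModel I m) (Jet.pt : Jet p → Y) z :=
  mdifferentiableAt_of_comp_chartAt_symm (mem_chart_source _ z)
    (hasMFDerivAt_pt_comp_chartAt_symm z (mem_chart_target _ z)).mdifferentiableAt

lemma mdifferentiableAt_base (z : Jet p) :
    MDifferentiableAt (jetModel I m) I (Jet.base : Jet p → X) z :=
  mdifferentiableAt_of_comp_chartAt_symm (mem_chart_source _ z)
    (hasMFDerivAt_base_comp_chartAt_symm z (mem_chart_target _ z)).mdifferentiableAt

/-- The tangent map of the inverse of the preferred chart at `z₀`. -/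
def dChartSymm (z₀ : Jet p) (h : Model H n m) : JetSpace n m →L[ℝ] JetSpace n m :=
  mfderiv (jetModel I m) (jetModel I m) (chartAt (Model H n m) z₀).symm h

lemma mfderiv_pt_dChartSymm (z₀ : Jet p) {h : Model H n m}
    (hh : h ∈ (chartAt (Model H n m) z₀).target) (V : JetSpace n m) :
    mfderiv (jetModel I m) (totalModel I m) (Jet.pt : Jet p → Y)
      ((chartAt (Model H n m) z₀).symm h) (dChartSymm z₀ h V) =
      (p.fiberedChartAt z₀.pt).dTotalSymm h.1 V.1 := by
  have h1 := HasMFDerivAt.comp h (mdifferentiableAt_pt _).hasMFDerivAt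
    ((mdifferentiable_chartAt z₀).mdifferentiableAt_symm hh).hasMFDerivAt
  exact DFunLike.congr_fun (hasMFDerivAt_unique h1 (hasMFDerivAt_pt_comp_chartAt_symm z₀ hh)) V

lemma mfderiv_base_dChartSymm (z₀ : Jet p) {h : Model H n m}
    (hh : h ∈ (chartAt (Model H n m) z₀).target) (V : JetSpace n m) :
    mfderiv (jetModel I m) I (Jet.base : Jet p → X)
      ((chartAt (Model H n m) z₀).symm h) (dChartSymm z₀ h V) =
      (p.fiberedChartAt z₀.pt).dBaseSymm h.1.1 V.1.1 := by
  have h1 := HasMFDerivAt.comp h (mdifferentiableAt_base _).hasMFDerivAt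
    ((mdifferentiable_chartAt z₀).mdifferentiableAt_symm hh).hasMFDerivAt
  exact DFunLike.congr_fun (hasMFDerivAt_unique h1 (hasMFDerivAt_base_comp_chartAt_symm z₀ hh)) V

/-- `verticalLift` is defined with the fibred chart at the point `z` itself, whereas computations
take place in the chart at a fixed `z₀`. Over a fixed point of `Y` the change between the two jet
coordinates is affine in the `z`-coordinates, and its linear part is the vertical lift. -/
lemma dChartSymm_inr (z₀ : Jet p) {h : Model H n m}
    (hh : h ∈ (chartAt (Model H n m) z₀).target) (B : BaseSpace n →L[ℝ] FibreSpace m) :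
    dChartSymm z₀ h ((0, 0), B) = verticalLift p ((chartAt (Model H n m) z₀).symm h)
      ((((p.fiberedChartAt z₀.pt).dTotalSymm h.1).comp
        (ContinuousLinearMap.prod (0 : BaseSpace n →L[ℝ] BaseSpace n) B)).comp
        ((p.fiberedChartAt z₀.pt).dBase (p.proj ((chartAt (Model H n m) z₀).symm h).pt))) := by
  set c := chartAt (Model H n m) z₀ with hc
  set κ := p.fiberedChartAt z₀.pt with hκ
  set z := c.symm h with hz
  set κz := p.fiberedChartAt z.pt with hκz
  have hD : HasFDerivWithinAt (fun q : JetSpace n m =>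
      jetModel I m (κz.coord (c.symm ((jetModel I m).symm q)))) (dChartSymm z₀ h)
      (range (jetModel I m)) (jetModel I m h) :=
    ((mdifferentiable_chartAt z₀).mdifferentiableAt_symm hh).hasMFDerivAt.2
  have hι : HasFDerivWithinAt (fun B' : BaseSpace n →L[ℝ] FibreSpace m =>
      (((totalModel I m) h.1, B') : JetSpace n m))
      (ContinuousLinearMap.inr ℝ (BaseSpace n × FibreSpace m) _) univ h.2 :=
    (hasFDerivAt_prodMk_right _ _).hasFDerivWithinAt
  have hmaps : MapsTo (fun B' : BaseSpace n →L[ℝ] FibreSpace m =>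
      (((totalModel I m) h.1, B') : JetSpace n m)) univ (range (jetModel I m)) :=
    fun B' _ => ⟨(h.1, B'), rfl⟩
  -- Restricted to a fibre of `Z → Y` the coordinates are unconstrained, so the derivative within
  -- the range becomes an ordinary one.
  have hcomp := HasFDerivWithinAt.comp h.2 (t := range (jetModel I m)) hD hι hmaps
  rw [hasFDerivWithinAt_univ] at hcomp
  have hpt : κ.total.symm h.1 = z.pt := by rw [hz, chartAt_symm_apply z₀ hh]; rfl
  let S : (BaseSpace n × FibreSpace m) →L[ℝ] FibreSpace m :=
    (ContinuousLinearMap.snd ℝ _ _).comp ((κz.dTotal z.pt).comp (κ.dTotalSymm h.1))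
  let R : BaseSpace n →L[ℝ] BaseSpace n :=
    (κ.dBase (p.proj z.pt)).comp (κz.dBaseSymm (κz.base (p.proj z.pt)))
  let A : (BaseSpace n →L[ℝ] FibreSpace m) →L[ℝ] (BaseSpace n →L[ℝ] FibreSpace m) :=
    (ContinuousLinearMap.compL ℝ (BaseSpace n) (FibreSpace m) (FibreSpace m)
      (S.comp (ContinuousLinearMap.inr ℝ _ _))).comp
    ((ContinuousLinearMap.compL ℝ (BaseSpace n) (BaseSpace n) (FibreSpace m)).flip R)
  let a₀ : BaseSpace n →L[ℝ] FibreSpace m := (S.comp (ContinuousLinearMap.inl ℝ _ _)).comp R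
  -- The transition map on the fibre: `R` changes the base vector, `S` the vector in `Y`, and
  -- splitting `S (R v, B' (R v))` yields the constant `a₀` and the linear part `A`.
  have hval : ∀ B' : BaseSpace n →L[ℝ] FibreSpace m,
      jetModel I m (κz.coord (c.symm ((jetModel I m).symm
        (((totalModel I m) h.1, B') : JetSpace n m)))) =
      ((totalModel I m) (κz.total z.pt), a₀ + A B') := fun B' => by
    have h1 : (jetModel I m).symm (((totalModel I m) h.1, B') : JetSpace n m) = (h.1, B') :=
      (jetModel I m).left_inv (h.1, B')
    have hh' : ((h.1, B') : Model H n m) ∈ c.target := hh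
    rw [h1, chartAt_symm_apply z₀ hh']
    have h2 : (κ.ofCoord h.1 hh B').pt = z.pt := hpt
    refine Prod.ext (congrArg (fun y => (totalModel I m) (κz.total y)) h2) ?_
    ext v : 1
    change (κz.coord (κ.ofCoord h.1 hh B')).2 v = _
    rw [FiberedChart.coord_snd_apply]
    change (κz.dTotal (κ.total.symm h.1) (κ.dTotalSymm h.1 (((ContinuousLinearMap.id ℝ _).prod B')
      (κ.dBase (p.proj (κ.total.symm h.1))
        (κz.dBaseSymm (κz.base (p.proj (κ.total.symm h.1))) v))))).2 = S (R v, 0) + S (0, B' (R v))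
    rw [hpt, ← map_add, Prod.mk_add_mk, add_zero, zero_add]
    rfl
  have hg : HasFDerivAt (fun B' : BaseSpace n →L[ℝ] FibreSpace m =>
      (((totalModel I m) (κz.total z.pt), a₀ + A B') : JetSpace n m))
      ((ContinuousLinearMap.inr ℝ (BaseSpace n × FibreSpace m) _).comp A) h.2 :=
    (hasFDerivAt_prodMk_right _ _).comp h.2 (A.hasFDerivAt.const_add a₀)
  have hcomp' : HasFDerivAt (fun B' : BaseSpace n →L[ℝ] FibreSpace m =>
      (((totalModel I m) (κz.total z.pt), a₀ + A B') : JetSpace n m))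
      ((dChartSymm z₀ h).comp (ContinuousLinearMap.inr ℝ (BaseSpace n × FibreSpace m) _)) h.2 :=
    hcomp.congr_of_eventuallyEq (Eventually.of_forall fun B' => (hval B').symm)
  exact DFunLike.congr_fun (hcomp'.unique hg) B

end Jet

end JetCharts

/-! ### The density of the volume form, and the intrinsic operations on the jet bundle in
coordinates. -/

noncomputable section CartanInCharts

lemma ContDiffOn.fderivWithin_range {E W H : Type*} [NormedAddCommGroup E] [NormedSpace ℝ E]
    [NormedAddCommGroup W] [NormedSpace ℝ W] [TopologicalSpace H] {I : ModelWithCorners ℝ E H}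
    {Q : Set H} (hQ : IsOpen Q) {f : E → W} (hf : ContDiffOn ℝ ∞ f (I.symm ⁻¹' Q ∩ range I)) :
    ContDiffOn ℝ ∞ (fderivWithin ℝ f (range I)) (I.symm ⁻¹' Q ∩ range I) := by
  refine (hf.fderivWithin (I.uniqueDiffOn_preimage hQ) (m := ∞) (by simp)).congr fun u hu => ?_
  rw [inter_comm, fderivWithin_inter]
  exact (hQ.preimage I.continuous_symm).mem_nhds hu.1

variable {n m : ℕ} {H : Type*} [TopologicalSpace H] {I : ModelWithCorners ℝ (BaseSpace n) H}
  {X : Type*} [TopologicalSpace X] [ChartedSpace H X] [IsManifold I ∞ X]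
  {Y : Type*} [TopologicalSpace Y] [ChartedSpace (ModelProd H (FibreSpace m)) Y]
  [IsManifold (totalModel I m) ∞ Y]
  {p : Fibration I (FibreSpace m) X Y}

namespace FiberedChart

variable (κ : FiberedChart I (FibreSpace m) p.proj)

/-- The density of `η` in the coordinates `x^μ`: `η = ρ dx^0 ∧ … ∧ dx^n`. -/
def density (η : DForm I X (n + 1)) (u : BaseSpace n) : ℝ :=
  η (κ.base.symm (I.symm u)) (fun ν => κ.dBaseSymm (I.symm u) (coordVec ν))

lemma hasMFDerivWithinAt_base_symm {u : BaseSpace n} (hu : u ∈ range I)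
    (hu' : I.symm u ∈ κ.base.target) :
    HasMFDerivWithinAt 𝓘(ℝ, BaseSpace n) I (κ.base.symm ∘ I.symm) (range I) u
      (κ.dBaseSymm (I.symm u)) := by
  have h1 := (κ.mdiffBase.mdifferentiableAt_symm hu').hasMFDerivAt
  exact HasMFDerivAt.comp_hasMFDerivWithinAt u h1 (I.hasMFDerivWithinAt_symm hu)

/-- Smoothness of `η` refers to preferred charts only, while `κ.base` is any chart of the maximal
atlas. Near each point the density is therefore rewritten as the representative of `η` in the
preferred chart there, evaluated on the derivatives of the smooth transition map `τ`. -/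
lemma contDiffOn_density {η : DForm I X (n + 1)} (hη : η.IsSmooth) :
    ContDiffOn ℝ ∞ (κ.density η) (I.symm ⁻¹' κ.base.target ∩ range I) := by
  have : IsManifold I 1 X := IsManifold.of_le (n := ∞) (by simp)
  intro u hu
  set x₀ := κ.base.symm (I.symm u) with hx₀
  set Q := (κ.base.symm.trans (chartAt H x₀)).source with hQ
  have hQo : IsOpen Q := (κ.base.symm.trans (chartAt H x₀)).open_source
  have hQ' : ∀ h, h ∈ Q ↔ h ∈ κ.base.target ∧ κ.base.symm h ∈ (chartAt H x₀).source := fun h => by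
    simp [hQ]
  set τ : BaseSpace n → BaseSpace n := extChartAt I x₀ ∘ (κ.base.symm ∘ I.symm) with hτ
  have hτs : ContDiffOn ℝ ∞ τ (I.symm ⁻¹' Q ∩ range I) := by
    have := IsManifold.compatible_of_mem_maximalAtlas κ.base_mem
      (IsManifold.chart_mem_maximalAtlas (I := I) (n := ∞) x₀)
    rw [contDiffGroupoid, mem_groupoid_of_pregroupoid] at this
    exact this.1
  have hmem : u ∈ I.symm ⁻¹' Q ∩ range I := ⟨(hQ' _).2 ⟨hu.1, mem_chart_source H x₀⟩, hu.2⟩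
  have hmaps : MapsTo τ (I.symm ⁻¹' Q ∩ range I) (extChartAt I x₀).target := fun w hw =>
    (extChartAt I x₀).map_source (by rw [extChartAt_source]; exact ((hQ' _).1 hw.1).2)
  have key : ContDiffOn ℝ ∞ (κ.density η) (I.symm ⁻¹' Q ∩ range I) := by
    have h1 : ContDiffOn ℝ ∞ (fun w => η.inChart x₀ (τ w)
        (fun ν => fderivWithin ℝ τ (range I) w (coordVec ν))) (I.symm ⁻¹' Q ∩ range I) := by
      refine ContDiffOn.continuousAlternatingMap_apply ((hη x₀).comp hτs hmaps) fun ν => ?_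
      exact (hτs.fderivWithin_range hQo).clm_apply contDiffOn_const
    refine h1.congr fun w hw => ?_
    have hw' := (hQ' _).1 hw.1
    have hsrc : (κ.base.symm ∘ I.symm) w ∈ (extChartAt I x₀).source := by
      rw [extChartAt_source]; exact hw'.2
    have hd := κ.hasMFDerivWithinAt_base_symm hw.2 hw'.1
    have h3 : ∀ y, y = κ.base.symm (I.symm w) → ∀ V : Fin (n + 1) → BaseSpace n,
      η y V = η (κ.base.symm (I.symm w)) V := by rintro _ rfl _; rfl
    refine Eq.symm ((h3 _ ((extChartAt I x₀).left_inv hsrc) _).trans ?_)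
    refine congrArg (η (κ.base.symm (I.symm w))) (funext fun ν => ?_)
    have h4 := mfderivWithin_extChartAt_symm_fderivWithin (I.uniqueDiffOn w hw.2)
      hd.mdifferentiableWithinAt hsrc (coordVec ν)
    rw [hd.mfderivWithin (I.uniqueDiffOn w hw.2).uniqueMDiffWithinAt] at h4
    exact h4
  refine (key u hmem).mono_of_mem_nhdsWithin ?_
  refine mem_nhdsWithin.2 ⟨I.symm ⁻¹' Q, hQo.preimage I.continuous_symm, hmem.1, ?_⟩
  rintro w ⟨hw, hw'⟩
  exact ⟨hw, hw'.2⟩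

end FiberedChart

namespace Jet

lemma proj_chartAt_symm (z₀ : Jet p) {h : Model H n m}
    (hh : h ∈ (chartAt (Model H n m) z₀).target) :
    p.proj ((chartAt (Model H n m) z₀).symm h).pt ∈ (p.fiberedChartAt z₀.pt).base.source ∧
    (p.fiberedChartAt z₀.pt).base (p.proj ((chartAt (Model H n m) z₀).symm h).pt) = h.1.1 := by
  set κ := p.fiberedChartAt z₀.pt
  rw [chartAt_symm_apply z₀ hh]
  have hs := κ.total.map_target hh
  refine ⟨κ.mapsTo hs, ?_⟩
  change κ.base (p.proj (κ.total.symm h.1)) = _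
  rw [← κ.fst_eq _ hs, κ.total.right_inv hh]

lemma lin_chartAt_symm (z₀ : Jet p) {h : Model H n m}
    (hh : h ∈ (chartAt (Model H n m) z₀).target) (v : BaseSpace n) :
    ((chartAt (Model H n m) z₀).symm h).lin ((p.fiberedChartAt z₀.pt).dBaseSymm h.1.1 v) =
      (p.fiberedChartAt z₀.pt).dTotalSymm h.1 (v, h.2 v) := by
  have h1 := proj_chartAt_symm z₀ hh
  rw [chartAt_symm_apply z₀ hh] at h1 ⊢
  set κ := p.fiberedChartAt z₀.pt
  have h2 := κ.dBase_dBaseSymm h1.1 v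
  rw [h1.2] at h2
  exact congrArg (fun a => κ.dTotalSymm h.1 (a, h.2 a)) h2

/-- The jet sends `∂/∂x^μ` to `∂/∂x^μ + z_μ`; subtracting this lift of the base component from the
image in `Y` leaves the contact forms as fibre component. -/
lemma verticalDiff_dChartSymm (z₀ : Jet p) {h : Model H n m}
    (hh : h ∈ (chartAt (Model H n m) z₀).target) (V : JetSpace n m) :
    verticalDiff p ((chartAt (Model H n m) z₀).symm h) (dChartSymm z₀ h V) =
      (p.fiberedChartAt z₀.pt).dTotalSymm h.1 (0, contactMap h.2 V) := by
  have h1 := mfderiv_pt_dChartSymm z₀ hh V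
  have h2 := mfderiv_base_dChartSymm z₀ hh V
  have h3 := lin_chartAt_symm z₀ hh V.1.1
  rw [← h2] at h3
  have h4 : (V.1 - (V.1.1, h.2 V.1.1) : BaseSpace n × FibreSpace m) = (0, contactMap h.2 V) :=
    Prod.ext (sub_self _) rfl
  rw [← h4, map_sub, ← h1, ← h3]
  rfl

lemma verticalLift_smulRight (z₀ : Jet p) {h : Model H n m}
    (hh : h ∈ (chartAt (Model H n m) z₀).target) (a : BaseSpace n →L[ℝ] ℝ) (w : FibreSpace m) :
    verticalLift p ((chartAt (Model H n m) z₀).symm h)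
      (a.smulRight ((p.fiberedChartAt z₀.pt).dTotalSymm h.1 (0, w))) =
      dChartSymm z₀ h ((0, 0),
        (a.comp ((p.fiberedChartAt z₀.pt).dBaseSymm h.1.1)).smulRight w) := by
  rw [dChartSymm_inr z₀ hh]
  refine congrArg (verticalLift p ((chartAt (Model H n m) z₀).symm h)) ?_
  have h1 := proj_chartAt_symm z₀ hh
  set κ := p.fiberedChartAt z₀.pt
  refine ContinuousLinearMap.ext fun v => ?_
  have h2 := κ.dBaseSymm_dBase h1.1 v
  rw [h1.2] at h2
  have h3 : ((0 : BaseSpace n), a v • w) = a v • ((0 : BaseSpace n), w) := by simp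
  refine Eq.trans ?_ (congrArg (fun b => κ.dTotalSymm h.1 (0, a b • w)) h2).symm
  change a v • κ.dTotalSymm h.1 (0, w) = κ.dTotalSymm h.1 (0, a v • w)
  rw [h3, map_smul]

/-- The differential of a function on the jet bundle. -/
def differential (L : Jet p → ℝ) (z : Jet p) : JetSpace n m →L[ℝ] ℝ :=
  mfderiv (jetModel I m) 𝓘(ℝ, ℝ) L z

end Jet

/-- This brings the intrinsic form into the same shape as `localCartan_apply`, with one base vector
replaced in each term. -/
lemma poincareCartan_apply (η : DForm I X (n + 1)) (L : Jet p → ℝ) (z : Jet p)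
    (V : Fin (n + 1) → JetSpace n m) :
    poincareCartan p η L z V =
      L z * η z.base (fun j => mfderiv (jetModel I m) I (Jet.base : Jet p → X) z (V j)) +
      ∑ k, ∑ ν, Jet.differential L z (verticalLift p z
        (ContinuousLinearMap.smulRightL ℝ (BaseSpace n) (BaseSpace n × FibreSpace m)
          (coordCovec ν) (verticalDiff p z (V k)))) *
        η z.base (Function.update
          (fun j => mfderiv (jetModel I m) I (Jet.base : Jet p → X) z (V j)) k (coordVec ν)) := by
  refine congrArg₂ (fun a b : ℝ => a + b) rfl ?_
  refine (ContinuousAlternatingMap.alternatizeUncurryFin_apply (𝕜 := ℝ) (E := JetSpace n m)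
    (F := ℝ) _ V).trans ?_
  refine Finset.sum_congr rfl fun k _ => ?_
  rw [_root_.sum_apply, ContinuousAlternatingMap.sum_apply, Finset.smul_sum]
  refine Finset.sum_congr rfl fun ν _ => ?_
  have h := neg_one_pow_smul_map_cons_removeNth (E := BaseSpace n) (η z.base) k (coordVec ν)
    (fun j => mfderiv (jetModel I m) I (Jet.base : Jet p → X) z (V j))
  refine Eq.trans ?_ (congrArg (fun b : ℝ => Jet.differential L z
      (verticalLift p z (ContinuousLinearMap.smulRightL ℝ (BaseSpace n)
      (BaseSpace n × FibreSpace m) (coordCovec ν) (verticalDiff p z (V k)))) * b) h)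
  refine Eq.trans ?_ (mul_smul_comm _ _ _).symm
  refine congrArg (fun b : ℝ => (-1 : ℤ) ^ (k : ℕ) • b) ?_
  refine congrArg₂ (fun a b : ℝ => a * b) rfl ?_
  refine congrArg (η z.base) (funext fun j => ?_)
  refine Fin.cases rfl (fun j => rfl) j

end CartanInCharts

/-! ### The intrinsic form equals the local one, and is smooth. -/

noncomputable section CartanSmooth

variable {n m : ℕ}

/-- This expresses that the sum over `ν` in the Poincaré-Cartan form is independent of the basis:
pulling the covectors back by `S` amounts to pushing the momentum vector forward by `S`. -/
lemma sum_smul_coordVec_eq_momentumMap (ℓ : JetSpace n m →L[ℝ] ℝ)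
    (S : BaseSpace n →L[ℝ] BaseSpace n) (w : FibreSpace m) :
    ∑ ν, ℓ ((0, 0), ((coordCovec ν).comp S).smulRight w) • coordVec ν =
      S (momentumMap n m ℓ w) := by
  have h : ∀ ν, ℓ ((0, 0), ((coordCovec ν).comp S).smulRight w) =
      ∑ μ, ℓ (vertVec n m μ w) * S (coordVec μ) ν := fun ν => by
    rw [← sum_vertVec, map_sum]
    refine Finset.sum_congr rfl fun μ _ => ?_
    change ℓ (vertVec n m μ ((S (coordVec μ) ν) • w)) = _
    rw [map_smul, map_smul, smul_eq_mul, mul_comm]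
  ext i
  rw [momentumMap_apply, map_sum]
  simp [Pi.single_apply, h]

lemma sum_mul_map_update_coordVec (α : BaseSpace n [⋀^Fin (n + 1)]→L[ℝ] ℝ)
    (v : Fin (n + 1) → BaseSpace n) (k : Fin (n + 1)) (c : Fin (n + 1) → ℝ) :
    ∑ ν, c ν * α (Function.update v k (coordVec ν)) =
      α (Function.update v k (∑ ν, c ν • coordVec ν)) := by
  refine Eq.symm ((α.toAlternatingMap.map_update_sum Finset.univ k _ _).trans ?_)
  exact Finset.sum_congr rfl fun ν _ => α.toAlternatingMap.map_update_smul v k (c ν) (coordVec ν)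

variable {H : Type*} [TopologicalSpace H] {I : ModelWithCorners ℝ (BaseSpace n) H}
  {X : Type*} [TopologicalSpace X] [ChartedSpace H X] [IsManifold I ∞ X]
  {Y : Type*} [TopologicalSpace Y] [ChartedSpace (ModelProd H (FibreSpace m)) Y]
  [IsManifold (totalModel I m) ∞ Y]
  {p : Fibration I (FibreSpace m) X Y}

namespace Jet

lemma isOpen_chartAt_target (z₀ : Jet p) : IsOpen (chartAt (Model H n m) z₀).target :=
  (chartAt (Model H n m) z₀).open_target

lemma extChartAt_target_eq (z₀ : Jet p) : (extChartAt (jetModel I m) z₀).target =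
    (jetModel I m).symm ⁻¹' (chartAt (Model H n m) z₀).target ∩ range (jetModel I m) :=
  (chartAt (Model H n m) z₀).extend_target

lemma contDiffOn_localLagrangian {η : DForm I X (n + 1)} (hη : η.IsSmooth) {L : Jet p → ℝ}
    (hL : ContMDiff (jetModel I m) 𝓘(ℝ, ℝ) ∞ L) (z₀ : Jet p) :
    ContDiffOn ℝ ∞ (localLagrangian p η L (p.fiberedChartAt z₀.pt) z₀)
      ((jetModel I m).symm ⁻¹' (chartAt (Model H n m) z₀).target ∩ range (jetModel I m)) := by
  have h1 : ContDiffOn ℝ ∞ (L ∘ (extChartAt (jetModel I m) z₀).symm)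
      (extChartAt (jetModel I m) z₀).target :=
    (hL.comp_contMDiffOn (contMDiffOn_extChartAt_symm z₀)).contDiffOn
  rw [extChartAt_target_eq] at h1
  have h2 := (p.fiberedChartAt z₀.pt).contDiffOn_density hη
  have h3 : ContDiffOn ℝ ∞ (fun q : JetSpace n m =>
      (p.fiberedChartAt z₀.pt).density η (jetFst n m q))
      ((jetModel I m).symm ⁻¹' (chartAt (Model H n m) z₀).target ∩ range (jetModel I m)) := by
    refine h2.comp (jetFst n m).contDiff.contDiffOn ?_
    rintro _ ⟨hq, ⟨h, rfl⟩⟩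
    rw [mem_preimage, ModelWithCorners.left_inv] at hq
    refine ⟨?_, ⟨h.1.1, rfl⟩⟩
    change I.symm (I h.1.1) ∈ (p.fiberedChartAt z₀.pt).base.target
    rw [I.left_inv]
    obtain ⟨ha, hb⟩ := proj_chartAt_symm z₀ hq
    rw [← hb]
    exact (p.fiberedChartAt z₀.pt).base.map_source ha
  exact h1.mul h3

lemma hasFDerivWithinAt_comp_chartAt_symm {L : Jet p → ℝ}
    (hL : ContMDiff (jetModel I m) 𝓘(ℝ, ℝ) ∞ L) (z₀ : Jet p) {h : Model H n m}
    (hh : h ∈ (chartAt (Model H n m) z₀).target) :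
    HasFDerivWithinAt (fun q => L ((chartAt (Model H n m) z₀).symm ((jetModel I m).symm q)))
      ((differential L ((chartAt (Model H n m) z₀).symm h)).comp (dChartSymm z₀ h))
      (range (jetModel I m)) (jetModel I m h) :=
  (HasMFDerivAt.comp h ((hL.mdifferentiable (by simp) _).hasMFDerivAt)
    ((mdifferentiable_chartAt z₀).mdifferentiableAt_symm hh).hasMFDerivAt).2

lemma mem_preimage_target (z₀ : Jet p) {h : Model H n m}
    (hh : h ∈ (chartAt (Model H n m) z₀).target) : jetModel I m h ∈
      (jetModel I m).symm ⁻¹' (chartAt (Model H n m) z₀).target ∩ range (jetModel I m) := by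
  refine ⟨?_, mem_range_self h⟩
  rw [mem_preimage, ModelWithCorners.left_inv]
  exact hh

lemma preimage_target_mem_nhdsWithin (z₀ : Jet p) {h : Model H n m}
    (hh : h ∈ (chartAt (Model H n m) z₀).target) :
      (jetModel I m).symm ⁻¹' (chartAt (Model H n m) z₀).target ∩ range (jetModel I m) ∈
      𝓝[range (jetModel I m)] (jetModel I m h) := by
  rw [inter_comm]
  exact inter_mem_nhdsWithin _ (((isOpen_chartAt_target z₀).preimage
    (jetModel I m).continuous_symm).mem_nhds (mem_preimage_target z₀ hh).1)

/-- `Λ` is `L` times the density of `η`, and the density depends on the base point alone, so it acts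
as a constant under vertical differentiation. -/
lemma fderivWithin_localLagrangian_vertical {η : DForm I X (n + 1)} (hη : η.IsSmooth)
    {L : Jet p → ℝ} (hL : ContMDiff (jetModel I m) 𝓘(ℝ, ℝ) ∞ L) (z₀ : Jet p) {h : Model H n m}
    (hh : h ∈ (chartAt (Model H n m) z₀).target) (B : BaseSpace n →L[ℝ] FibreSpace m) :
    fderivWithin ℝ (localLagrangian p η L (p.fiberedChartAt z₀.pt) z₀) (range (jetModel I m))
      (jetModel I m h) ((0, 0), B) = (p.fiberedChartAt z₀.pt).density η (I h.1.1) *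
        differential L ((chartAt (Model H n m) z₀).symm h) (dChartSymm z₀ h ((0, 0), B)) := by
  have hbase : h.1.1 ∈ (p.fiberedChartAt z₀.pt).base.target := by
    obtain ⟨ha, hb⟩ := proj_chartAt_symm z₀ hh
    rw [← hb]
    exact (p.fiberedChartAt z₀.pt).base.map_source ha
  have hmem : I h.1.1 ∈ I.symm ⁻¹' (p.fiberedChartAt z₀.pt).base.target ∩ range I := by
    refine ⟨?_, mem_range_self _⟩
    rw [mem_preimage, I.left_inv]
    exact hbase
  have h2 : DifferentiableWithinAt ℝ ((p.fiberedChartAt z₀.pt).density η) (range I) (I h.1.1) := by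
    refine (((p.fiberedChartAt z₀.pt).contDiffOn_density hη _ hmem).differentiableWithinAt
      (by simp)).mono_of_mem_nhdsWithin ?_
    rw [inter_comm]
    exact inter_mem_nhdsWithin _ (((p.fiberedChartAt z₀.pt).base.open_target.preimage
      I.continuous_symm).mem_nhds hmem.1)
  have h3 : HasFDerivWithinAt (fun q : JetSpace n m =>
      (p.fiberedChartAt z₀.pt).density η (jetFst n m q)) ((fderivWithin ℝ
        ((p.fiberedChartAt z₀.pt).density η) (range I) (I h.1.1)).comp (jetFst n m))
      (range (jetModel I m)) (jetModel I m h) := by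
    refine HasFDerivWithinAt.comp (t := range I) (jetModel I m h) h2.hasFDerivWithinAt
      (jetFst n m).hasFDerivWithinAt ?_
    rintro _ ⟨h', rfl⟩
    exact ⟨h'.1.1, rfl⟩
  have h4 := (hasFDerivWithinAt_comp_chartAt_symm hL z₀ hh).mul h3
  have h5 : HasFDerivWithinAt (localLagrangian p η L (p.fiberedChartAt z₀.pt) z₀) _
    (range (jetModel I m)) (jetModel I m h) := h4
  rw [h5.fderivWithin ((jetModel I m).uniqueDiffOn _ (mem_range_self h))]
  have h6 : jetFst n m (((0, 0), B) : JetSpace n m) = 0 := rfl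
  simp only [_root_.add_apply, _root_.smul_apply, ContinuousLinearMap.comp_apply, h6,
    map_zero, mul_zero, zero_add, smul_eq_mul]
  rfl

/-- With `S` the tangent map of the inverse base chart, `η` pulls back to `ρ vol`. In the momentum
term, `S` moves from the covectors onto the momentum vector, after which all slots contain images
under `S`; the factor `ρ` turns the momenta of `L` into those of `Λ`. -/
lemma poincareCartan_dChartSymm {η : DForm I X (n + 1)} (hη : η.IsSmooth)
    {L : Jet p → ℝ} (hL : ContMDiff (jetModel I m) 𝓘(ℝ, ℝ) ∞ L) (z₀ : Jet p) {h : Model H n m}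
    (hh : h ∈ (chartAt (Model H n m) z₀).target) (V : Fin (n + 1) → JetSpace n m) :
    poincareCartan p η L ((chartAt (Model H n m) z₀).symm h) (fun j => dChartSymm z₀ h (V j)) =
      localCartan (localLagrangian p η L (p.fiberedChartAt z₀.pt) z₀) (range (jetModel I m))
        (jetModel I m h) V := by
  rw [poincareCartan_apply, localCartan_apply]
  set c := chartAt (Model H n m) z₀ with hc
  set κ := p.fiberedChartAt z₀.pt with hκ
  set z := c.symm h with hz
  set S : BaseSpace n →L[ℝ] BaseSpace n := κ.dBaseSymm h.1.1 with hS
  set ρ : ℝ := κ.density η (I h.1.1) with hρ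
  set ℓ : JetSpace n m →L[ℝ] ℝ := (differential L z).comp (dChartSymm z₀ h) with hℓ
  have hbase : z.base = κ.base.symm h.1.1 := by
    obtain ⟨ha, hb⟩ := proj_chartAt_symm z₀ hh
    rw [← hb, κ.base.left_inv ha]
    rfl
  have hηS : ∀ v : Fin (n + 1) → BaseSpace n, η z.base (fun j => S (v j)) = ρ * volForm n v := by
    intro v
    have h1 := DFunLike.congr_fun (eq_smul_volForm (ContinuousAlternatingMap.compContinuousLinearMap
      (M' := BaseSpace n) (η z.base) S)) v
    refine h1.trans ?_
    refine congrArg (fun a : ℝ => a * volForm n v) ?_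
    change η z.base (fun ν => S (coordVec ν)) = κ.density η (I h.1.1)
    rw [FiberedChart.density, I.left_inv]
    have h3 : ∀ y y', y = y' → ∀ V : Fin (n + 1) → BaseSpace n, η y V = η y' V := by
      rintro _ _ rfl _; rfl
    exact h3 _ _ hbase _
  have hT : ∀ j, mfderiv (jetModel I m) I (Jet.base : Jet p → X) z (dChartSymm z₀ h (V j)) =
      S (V j).1.1 := fun j => mfderiv_base_dChartSymm z₀ hh (V j)
  have hlift : ∀ k ν, verticalLift p z
        (ContinuousLinearMap.smulRightL ℝ (BaseSpace n) (BaseSpace n × FibreSpace m)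
          (coordCovec ν) (verticalDiff p z (dChartSymm z₀ h (V k)))) =
      dChartSymm z₀ h ((0, 0), ((coordCovec ν).comp S).smulRight (contactMap h.2 (V k))) := by
    intro k ν
    rw [verticalDiff_dChartSymm z₀ hh]
    exact verticalLift_smulRight z₀ hh (coordCovec ν) _
  have hmom : ∀ w, momentumMap n m (fderivWithin ℝ (localLagrangian p η L κ z₀)
      (range (jetModel I m)) (jetModel I m h)) w = ρ • momentumMap n m ℓ w := by
    intro w
    ext i
    rw [momentumMap_apply_coord, PiLp.smul_apply, momentumMap_apply_coord]
    exact fderivWithin_localLagrangian_vertical hη hL z₀ hh _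
  have hΛ : localLagrangian p η L κ z₀ (jetModel I m h) = L z * ρ := by
    change L (c.symm ((jetModel I m).symm (jetModel I m h))) * κ.density η (I h.1.1) = _
    rw [(jetModel I m).left_inv]
  have hupd : ∀ k (a : BaseSpace n), Function.update (fun j => S (V j).1.1) k (S a) =
      fun j => S (Function.update (fun j => (V j).1.1) k a j) := fun k a => by
    funext j
    by_cases hj : j = k
    · subst hj; simp
    · simp [hj]
  refine congrArg₂ (fun a b : ℝ => a + b) ?_ (Finset.sum_congr rfl fun k _ => ?_)
  · rw [hΛ, mul_assoc, ← hηS]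
    exact congrArg (fun v => L z * η z.base v) (funext hT)
  · have h1 : ∀ ν, differential L z (verticalLift p z
        (ContinuousLinearMap.smulRightL ℝ (BaseSpace n) (BaseSpace n × FibreSpace m)
          (coordCovec ν) (verticalDiff p z (dChartSymm z₀ h (V k))))) =
        ℓ ((0, 0), ((coordCovec ν).comp S).smulRight (contactMap h.2 (V k))) := fun ν => by
      rw [hlift]; rfl
    have h2 : (fun j => mfderiv (jetModel I m) I (Jet.base : Jet p → X) z
        (dChartSymm z₀ h (V j))) = fun j => S (V j).1.1 := funext hT
    simp only [h1]
    refine (congrArg (fun v : Fin (n + 1) → BaseSpace n => ∑ ν, ℓ ((0, 0), ((coordCovec ν).comp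
      S).smulRight (contactMap h.2 (V k))) * η z.base (Function.update v k (coordVec ν))) h2).trans ?_
    refine (sum_mul_map_update_coordVec (η z.base) _ k _).trans ?_
    rw [sum_smul_coordVec_eq_momentumMap, hupd]
    refine (hηS _).trans ?_
    rw [hmom]
    exact ((volForm n).map_update_smul _ k ρ _).symm

lemma mfderivWithin_extChartAt_symm_eq (z₀ : Jet p) {h : Model H n m}
    (hh : h ∈ (chartAt (Model H n m) z₀).target) (v : JetSpace n m) :
    mfderivWithin 𝓘(ℝ, JetSpace n m) (jetModel I m) (extChartAt (jetModel I m) z₀).symm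
      (range (jetModel I m)) (jetModel I m h) v = dChartSymm z₀ h v := by
  have h1 := ((mdifferentiable_chartAt z₀).mdifferentiableAt_symm
    (x := (jetModel I m).symm (jetModel I m h))
    (by rw [(jetModel I m).left_inv]; exact hh)).hasMFDerivAt
  have h2 := HasMFDerivAt.comp_hasMFDerivWithinAt (jetModel I m h) h1
    ((jetModel I m).hasMFDerivWithinAt_symm (mem_range_self h))
  have h3 := h2.mfderivWithin
    ((jetModel I m).uniqueDiffOn _ (mem_range_self h)).uniqueMDiffWithinAt
  refine (DFunLike.congr_fun h3 v).trans ?_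
  have h4 : ∀ h', h' = h → dChartSymm z₀ h' v = dChartSymm z₀ h v := by rintro _ rfl; rfl
  exact h4 _ ((jetModel I m).left_inv h)

/-- The Poincaré-Cartan form in the coordinates `(x^μ, y^i, z^i_μ)`. -/
lemma inChart_poincareCartan {η : DForm I X (n + 1)} (hη : η.IsSmooth)
    {L : Jet p → ℝ} (hL : ContMDiff (jetModel I m) 𝓘(ℝ, ℝ) ∞ L) (z₀ : Jet p) {q : JetSpace n m}
    (hq : q ∈ (extChartAt (jetModel I m) z₀).target) :
    (poincareCartan p η L).inChart z₀ q =
      localCartan (localLagrangian p η L (p.fiberedChartAt z₀.pt) z₀) (range (jetModel I m)) q := by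
  rw [extChartAt_target_eq] at hq
  obtain ⟨hq, ⟨h, rfl⟩⟩ := hq
  rw [mem_preimage, ModelWithCorners.left_inv] at hq
  ext V
  rw [← poincareCartan_dChartSymm hη hL z₀ hq]
  have h4 : ∀ z z' : Jet p, z = z' → ∀ W : Fin (n + 1) → JetSpace n m,
      poincareCartan p η L z W = poincareCartan p η L z' W := by rintro _ _ rfl _; rfl
  refine (h4 _ _ (congrArg (chartAt (Model H n m) z₀).symm ((jetModel I m).left_inv h)) _).trans ?_
  refine congrArg (poincareCartan p η L _) (funext fun j => ?_)
  exact mfderivWithin_extChartAt_symm_eq z₀ hq (V j)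

lemma isSmooth_poincareCartan {η : DForm I X (n + 1)} (hη : η.IsSmooth)
    {L : Jet p → ℝ} (hL : ContMDiff (jetModel I m) 𝓘(ℝ, ℝ) ∞ L) :
    (poincareCartan p η L).IsSmooth := by
  intro z₀
  have h := contDiffOn_localLagrangian hη hL z₀
  have h' := h.fderivWithin_range (isOpen_chartAt_target z₀)
  have h2 := contDiffOn_localCartan h h'
  rw [← extChartAt_target_eq] at h2
  exact h2.congr fun q hq => inChart_poincareCartan hη hL z₀ hq

end Jet

end CartanSmooth

/-! ### Prolonged sections in coordinates. -/

noncomputable section Prolongation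

variable {n m : ℕ} {H : Type*} [TopologicalSpace H] {I : ModelWithCorners ℝ (BaseSpace n) H}
  {X : Type*} [TopologicalSpace X] [ChartedSpace H X] [IsManifold I ∞ X]
  {Y : Type*} [TopologicalSpace Y] [ChartedSpace (ModelProd H (FibreSpace m)) Y]
  [IsManifold (totalModel I m) ∞ Y]
  {p : Fibration I (FibreSpace m) X Y}

namespace IsLocalSection

variable {U : Set X} {φ : X → Y}

lemma mdifferentiableAt (hφ : IsLocalSection p U φ) {x : X} (hx : x ∈ U) :
    MDifferentiableAt I (totalModel I m) φ x :=
  (hφ.contMDiffOn.contMDiffAt (hφ.isOpen.mem_nhds hx)).mdifferentiableAt (by simp)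

lemma mfderiv_proj_mfderiv (hφ : IsLocalSection p U φ) {x : X} (hx : x ∈ U) (v : BaseSpace n) :
    mfderiv (totalModel I m) I p.proj (φ x) (mfderiv I (totalModel I m) φ x v) = v := by
  have h1 : MDifferentiableAt (totalModel I m) I p.proj (φ x) :=
    (p.fiberedChartAt (φ x)).mdifferentiableAt_proj (p.exists_chart (φ x)).choose_spec
  have h2 := h1.hasMFDerivAt.comp x (hφ.mdifferentiableAt hx).hasMFDerivAt
  have h3 := (hasMFDerivAt_id (I := I) x).congr_of_eventuallyEq (f₁ := p.proj ∘ φ) (by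
    filter_upwards [hφ.isOpen.mem_nhds hx] with y hy using hφ.proj_eq y hy)
  exact DFunLike.congr_fun (hasMFDerivAt_unique h2 h3) v

lemma jet1_eq (hφ : IsLocalSection p U φ) {x : X} (hx : x ∈ U) :
    jet1 p φ x = ⟨φ x, mfderiv I (totalModel I m) φ x,
      ContinuousLinearMap.ext fun v => (hφ.mfderiv_proj_mfderiv hx v).trans (by
        rfl)⟩ := by
  rw [jet1, dif_pos ⟨hφ.proj_eq x hx, hφ.mfderiv_proj_mfderiv hx⟩]

variable (κ : FiberedChart I (FibreSpace m) p.proj)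

variable (U φ) in
/-- The part of `U` where the values of `φ` lie in the domain of fibred coordinates. -/
def domain : Set X := U ∩ φ ⁻¹' κ.total.source

variable (U φ) in
/-- The points of the model space corresponding to `domain`. -/
def modelDomain : Set H := κ.base.target ∩ κ.base.symm ⁻¹' domain U φ κ

lemma isOpen_domain (hφ : IsLocalSection p U φ) : IsOpen (domain U φ κ) :=
  hφ.contMDiffOn.continuousOn.isOpen_inter_preimage hφ.isOpen κ.total.open_source

lemma isOpen_modelDomain (hφ : IsLocalSection p U φ) : IsOpen (modelDomain U φ κ) :=
  κ.base.symm.isOpen_inter_preimage (hφ.isOpen_domain κ)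

lemma mem_base_source (hφ : IsLocalSection p U φ) {x : X} (hx : x ∈ domain U φ κ) :
    x ∈ κ.base.source := by
  have := κ.mapsTo hx.2
  rwa [hφ.proj_eq x hx.1] at this

/-- The section `u ↦ (u, f u)` in fibred coordinates. -/
def graphInCoord (φ : X → Y) (u : BaseSpace n) : BaseSpace n × FibreSpace m :=
  totalModel I m (κ.total (φ (κ.base.symm (I.symm u))))

lemma contMDiffOn_base_symm : ContMDiffOn 𝓘(ℝ, BaseSpace n) I ∞ (κ.base.symm ∘ I.symm)
    (I.symm ⁻¹' κ.base.target ∩ range I) :=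
  (contMDiffOn_symm_of_mem_maximalAtlas κ.base_mem).comp
    (I.contMDiffOn_symm.mono inter_subset_right) fun _ hu => hu.1

lemma contDiffOn_graphInCoord (hφ : IsLocalSection p U φ) :
    ContDiffOn ℝ ∞ (graphInCoord κ φ) (I.symm ⁻¹' modelDomain U φ κ ∩ range I) := by
  rw [← contMDiffOn_iff_contDiffOn]
  have h1 := (contMDiffOn_base_symm κ).mono (s := I.symm ⁻¹' κ.base.target ∩ range I)
    (t := I.symm ⁻¹' modelDomain U φ κ ∩ range I) (fun u hu => ⟨hu.1.1, hu.2⟩)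
  have h2 := hφ.contMDiffOn.comp h1 fun u hu => hu.1.2.1
  exact (κ.total.contMDiffOn_extend κ.total_mem).comp h2 fun u hu => hu.1.2.2

lemma hasFDerivWithinAt_graphInCoord (hφ : IsLocalSection p U φ) {u : BaseSpace n}
    (hu : u ∈ I.symm ⁻¹' modelDomain U φ κ ∩ range I) :
    HasFDerivWithinAt (graphInCoord κ φ) ((κ.dTotal (φ (κ.base.symm (I.symm u)))).comp
      (ContinuousLinearMap.comp (mfderiv I (totalModel I m) φ (κ.base.symm (I.symm u)) :
        BaseSpace n →L[ℝ] BaseSpace n × FibreSpace m) (κ.dBaseSymm (I.symm u))))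
      (range I) u := by
  have h1 := κ.hasMFDerivWithinAt_base_symm hu.2 hu.1.1
  have h2 := HasMFDerivAt.comp_hasMFDerivWithinAt u
    (hφ.mdifferentiableAt hu.1.2.1).hasMFDerivAt h1
  have h3 := HasMFDerivAt.comp_hasMFDerivWithinAt u
    (κ.mdiffTotal.mdifferentiableAt hu.1.2.2).hasMFDerivAt h2
  exact (HasMFDerivAt.comp_hasMFDerivWithinAt u
    (ModelWithCorners.hasMFDerivAt (totalModel I m)) h3).hasFDerivWithinAt

lemma graphInCoord_fst (hφ : IsLocalSection p U φ) {u : BaseSpace n}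
    (hu : u ∈ I.symm ⁻¹' modelDomain U φ κ ∩ range I) : (graphInCoord κ φ u).1 = u := by
  change I (κ.total (φ (κ.base.symm (I.symm u)))).1 = u
  rw [κ.fst_eq _ hu.1.2.2, hφ.proj_eq _ hu.1.2.1, κ.base.right_inv hu.1.1, I.right_inv hu.2]

/-- This is the holonomy of `j¹φ`: its `z`-coordinates are the derivatives of its `y`-coordinates.
-/
lemma jetInCoord_eq (hφ : IsLocalSection p U φ) {u : BaseSpace n}
    (hu : u ∈ I.symm ⁻¹' modelDomain U φ κ ∩ range I) :
    jetInCoord p κ φ u = (graphInCoord κ φ u, (ContinuousLinearMap.snd ℝ _ _).comp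
      (fderivWithin ℝ (graphInCoord κ φ) (range I) u)) := by
  rw [(hφ.hasFDerivWithinAt_graphInCoord κ hu).fderivWithin (I.uniqueDiffOn u hu.2), jetInCoord,
    hφ.jet1_eq hu.1.2.1]
  refine Prod.ext rfl ?_
  ext v : 1
  have h : κ.base (p.proj (φ (κ.base.symm (I.symm u)))) = I.symm u := by
    rw [hφ.proj_eq _ hu.1.2.1, κ.base.right_inv hu.1.1]
  change (κ.dTotal (φ (κ.base.symm (I.symm u))) (mfderiv I (totalModel I m) φ
    (κ.base.symm (I.symm u)) (κ.dBaseSymm (κ.base (p.proj (φ (κ.base.symm (I.symm u))))) v))).2 = _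
  rw [h]
  rfl

lemma contDiffOn_jetInCoord (hφ : IsLocalSection p U φ) :
    ContDiffOn ℝ ∞ (jetInCoord p κ φ) (I.symm ⁻¹' modelDomain U φ κ ∩ range I) := by
  have h1 := hφ.contDiffOn_graphInCoord κ
  have h2 := h1.fderivWithin_range (hφ.isOpen_modelDomain κ)
  exact (h1.prodMk (contDiffOn_const.clm_comp h2)).congr fun u hu => hφ.jetInCoord_eq κ hu

lemma modelDomain_mem_nhdsWithin (hφ : IsLocalSection p U φ) {u : BaseSpace n}
    (hu : u ∈ I.symm ⁻¹' modelDomain U φ κ ∩ range I) :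
    I.symm ⁻¹' modelDomain U φ κ ∩ range I ∈ 𝓝[range I] u := by
  rw [inter_comm]
  exact inter_mem_nhdsWithin _ (((hφ.isOpen_modelDomain κ).preimage
    I.continuous_symm).mem_nhds hu.1)

/-- By holonomy, vectors tangent to `j¹φ` are annihilated by the contact forms. This is the
hypothesis `hσ'` of the local Euler-Lagrange computation. -/
lemma fderivWithin_jetInCoord_fst (hφ : IsLocalSection p U φ) {u : BaseSpace n}
    (hu : u ∈ I.symm ⁻¹' modelDomain U φ κ ∩ range I) (v : BaseSpace n) :
    (fderivWithin ℝ (jetInCoord p κ φ) (range I) u v).1 = (v, (jetInCoord p κ φ u).2 v) := by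
  have hn := hφ.modelDomain_mem_nhdsWithin κ hu
  have hU := I.uniqueDiffOn u hu.2
  have h1 : DifferentiableWithinAt ℝ (jetInCoord p κ φ) (range I) u :=
    ((hφ.contDiffOn_jetInCoord κ u hu).differentiableWithinAt (by simp)).mono_of_mem_nhdsWithin hn
  have h2 : HasFDerivWithinAt (fun w => (jetInCoord p κ φ w).1) _ (range I) u :=
    h1.hasFDerivWithinAt.fst
  have h2' := h2.congr_of_eventuallyEq (f₁ := graphInCoord κ φ) (by
    filter_upwards [hn] with w hw
    rw [hφ.jetInCoord_eq κ hw]) (by rw [hφ.jetInCoord_eq κ hu])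
  have h3 := h2'.fderivWithin hU
  have h4 := (hφ.hasFDerivWithinAt_graphInCoord κ hu).differentiableWithinAt
  have h5 : HasFDerivWithinAt (fun w => (graphInCoord κ φ w).1) _ (range I) u :=
    h4.hasFDerivWithinAt.fst
  have h6 : HasFDerivWithinAt (fun w => (graphInCoord κ φ w).1) (ContinuousLinearMap.id ℝ _)
      (range I) u := by
    refine (hasFDerivWithinAt_id u (range I)).congr_of_eventuallyEq ?_ (hφ.graphInCoord_fst κ hu)
    filter_upwards [hn] with w hw using hφ.graphInCoord_fst κ hw
  have h7 := DFunLike.congr_fun (hU.eq h5 h6) v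
  rw [hφ.jetInCoord_eq κ hu]
  refine Eq.trans (DFunLike.congr_fun h3 v).symm ?_
  exact Prod.ext h7 rfl

/-- The prolongation of a section is smooth. -/
lemma contMDiffOn_jet1 (hφ : IsLocalSection p U φ) (z₀ : Jet p) :
    ContMDiffOn I (jetModel I m) ∞ (jet1 p φ) (domain U φ (p.fiberedChartAt z₀.pt)) := by
  set κ := p.fiberedChartAt z₀.pt with hκ
  have hmaps1 : MapsTo (κ.base.extend I) (domain U φ κ)
      (I.symm ⁻¹' modelDomain U φ κ ∩ range I) := by
    intro x hx
    have hb := hφ.mem_base_source κ hx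
    refine ⟨?_, mem_range_self _⟩
    change I.symm (I (κ.base x)) ∈ modelDomain U φ κ
    rw [I.left_inv]
    refine ⟨κ.base.map_source hb, ?_⟩
    rw [mem_preimage, κ.base.left_inv hb]
    exact hx
  have hpt : ∀ x ∈ domain U φ κ, jet1 p φ x ∈ (extChartAt (jetModel I m) z₀).source := by
    intro x hx
    rw [extChartAt_source, Jet.chartAt_source, hφ.jet1_eq hx.1]
    exact hx.2
  have hcoord : ∀ x ∈ domain U φ κ, jetInCoord p κ φ (κ.base.extend I x) =
      extChartAt (jetModel I m) z₀ (jet1 p φ x) := by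
    intro x hx
    change jetModel I m (κ.coord (jet1 p φ (κ.base.symm (I.symm (I (κ.base x)))))) = _
    rw [I.left_inv, κ.base.left_inv (hφ.mem_base_source κ hx)]
    rfl
  have h1 : ContMDiffOn I 𝓘(ℝ, BaseSpace n) ∞ (κ.base.extend I) (domain U φ κ) :=
    (κ.base.contMDiffOn_extend κ.base_mem).mono fun x hx => hφ.mem_base_source κ hx
  have h2 : ContMDiffOn I 𝓘(ℝ, JetSpace n m) ∞ (jetInCoord p κ φ ∘ κ.base.extend I)
      (domain U φ κ) :=
    (contMDiffOn_iff_contDiffOn.2 (hφ.contDiffOn_jetInCoord κ)).comp h1 hmaps1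
  have h3 := (contMDiffOn_extChartAt_symm (I := jetModel I m) (n := ∞) z₀).comp h2 (by
    intro x hx
    rw [mem_preimage, Function.comp_apply, hcoord x hx]
    exact (extChartAt (jetModel I m) z₀).map_source (hpt x hx))
  refine h3.congr fun x hx => ?_
  rw [Function.comp_apply, Function.comp_apply, hcoord x hx,
    (extChartAt (jetModel I m) z₀).left_inv (hpt x hx)]

end IsLocalSection

end Prolongation

/-! ### Pullback along prolonged sections, and Noether's theorem. -/

noncomputable section Noether

variable {n m : ℕ} {H : Type*} [TopologicalSpace H] {I : ModelWithCorners ℝ (BaseSpace n) H}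
  {X : Type*} [TopologicalSpace X] [ChartedSpace H X] [IsManifold I ∞ X]
  {Y : Type*} [TopologicalSpace Y] [ChartedSpace (ModelProd H (FibreSpace m)) Y]
  [IsManifold (totalModel I m) ∞ Y]
  {p : Fibration I (FibreSpace m) X Y}

namespace IsLocalSection

variable {U : Set X} {φ : X → Y}

lemma mem_domain_jet1 (hφ : IsLocalSection p U φ) {x : X} (hx : x ∈ U) :
    x ∈ domain U φ (p.fiberedChartAt (jet1 p φ x).pt) := by
  refine ⟨hx, ?_⟩
  have h : (jet1 p φ x).pt = φ x := by rw [hφ.jet1_eq hx]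
  have h' := (p.exists_chart (jet1 p φ x).pt).choose_spec
  have h'' : (jet1 p φ x).pt ∈ (p.fiberedChartAt (jet1 p φ x).pt).total.source := h'
  rw [mem_preimage]
  nth_rw 1 [← h]
  exact h''

lemma mdifferentiableAt_jet1 (hφ : IsLocalSection p U φ) {x : X} (hx : x ∈ U) :
    MDifferentiableAt I (jetModel I m) (jet1 p φ) x :=
  ((hφ.contMDiffOn_jet1 (jet1 p φ x)).contMDiffAt ((hφ.isOpen_domain _).mem_nhds
    (hφ.mem_domain_jet1 hx))).mdifferentiableAt (by simp)

lemma extend_base_mem (hφ : IsLocalSection p U φ) (κ : FiberedChart I (FibreSpace m) p.proj)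
    {x : X} (hx : x ∈ domain U φ κ) :
    I (κ.base x) ∈ I.symm ⁻¹' modelDomain U φ κ ∩ range I := by
  have hb := hφ.mem_base_source κ hx
  refine ⟨?_, mem_range_self _⟩
  rw [mem_preimage, I.left_inv]
  refine ⟨κ.base.map_source hb, ?_⟩
  rw [mem_preimage, κ.base.left_inv hb]
  exact hx

/-- The prolongation of `φ` as a function of the coordinates on the base. -/
def jetOfCoord (κ : FiberedChart I (FibreSpace m) p.proj) (φ : X → Y) : BaseSpace n → Jet p :=
  jet1 p φ ∘ (κ.base.symm ∘ I.symm)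

lemma hasMFDerivWithinAt_jetOfCoord (hφ : IsLocalSection p U φ)
    (κ : FiberedChart I (FibreSpace m) p.proj) {u : BaseSpace n}
    (hu : u ∈ I.symm ⁻¹' modelDomain U φ κ ∩ range I) :
    HasMFDerivWithinAt 𝓘(ℝ, BaseSpace n) (jetModel I m) (jetOfCoord κ φ) (range I) u
      (ContinuousLinearMap.comp (mfderiv I (jetModel I m) (jet1 p φ) (κ.base.symm (I.symm u)) :
        BaseSpace n →L[ℝ] JetSpace n m) (κ.dBaseSymm (I.symm u))) :=
  HasMFDerivAt.comp_hasMFDerivWithinAt u (hφ.mdifferentiableAt_jet1 hu.1.2.1).hasMFDerivAt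
    (κ.hasMFDerivWithinAt_base_symm hu.2 hu.1.1)

lemma mfderivWithin_jetOfCoord (hφ : IsLocalSection p U φ)
    (κ : FiberedChart I (FibreSpace m) p.proj) {u : BaseSpace n}
    (hu : u ∈ I.symm ⁻¹' modelDomain U φ κ ∩ range I) (v : BaseSpace n) :
    mfderivWithin 𝓘(ℝ, BaseSpace n) (jetModel I m) (jetOfCoord κ φ) (range I) u v =
      mfderiv I (jetModel I m) (jet1 p φ) (κ.base.symm (I.symm u)) (κ.dBaseSymm (I.symm u) v) := by
  rw [(hφ.hasMFDerivWithinAt_jetOfCoord κ hu).mfderivWithin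
    (I.uniqueDiffOn u hu.2).uniqueMDiffWithinAt]
  rfl

lemma contMDiffWithinAt_jetOfCoord (hφ : IsLocalSection p U φ) (z₀ : Jet p) {u : BaseSpace n}
    (hu : u ∈ I.symm ⁻¹' modelDomain U φ (p.fiberedChartAt z₀.pt) ∩ range I) :
    ContMDiffWithinAt 𝓘(ℝ, BaseSpace n) (jetModel I m) ∞
      (jetOfCoord (p.fiberedChartAt z₀.pt) φ) (range I) u := by
  have h1 := (contMDiffOn_base_symm (p.fiberedChartAt z₀.pt)).mono
    (t := I.symm ⁻¹' modelDomain U φ (p.fiberedChartAt z₀.pt) ∩ range I)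
    (fun u hu => ⟨hu.1.1, hu.2⟩)
  have h2 := (hφ.contMDiffOn_jet1 z₀).comp h1 fun u hu => hu.1.2
  exact (h2 u hu).mono_of_mem_nhdsWithin (hφ.modelDomain_mem_nhdsWithin _ hu)

/-- A form on the jet bundle vanishes along `j¹φ` at `x` if it does in coordinates. -/
lemma pullback_jet1_eq_zero (hφ : IsLocalSection p U φ) (κ : FiberedChart I (FibreSpace m) p.proj)
    {x : X} (hx : x ∈ domain U φ κ) {k : ℕ} {α : DForm (jetModel I m) (Jet p) k}
    (h : ∀ v : Fin k → BaseSpace n, α (jetOfCoord κ φ (I (κ.base x))) (fun i =>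
      mfderivWithin 𝓘(ℝ, BaseSpace n) (jetModel I m) (jetOfCoord κ φ) (range I) (I (κ.base x))
        (v i)) = 0) :
    DForm.pullback (I := I) (jet1 p φ) α x = 0 := by
  have hb := hφ.mem_base_source κ hx
  have hu := hφ.extend_base_mem κ hx
  have h1 : ∀ v : Fin k → BaseSpace n, α (jet1 p φ (κ.base.symm (I.symm (I (κ.base x)))))
      (fun i => mfderiv I (jetModel I m) (jet1 p φ) (κ.base.symm (I.symm (I (κ.base x))))
        (κ.dBaseSymm (I.symm (I (κ.base x))) (v i))) = 0 := fun v => by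
    refine Eq.trans (congrArg (α _) (funext fun i => ?_)) (h v)
    exact (hφ.mfderivWithin_jetOfCoord κ hu (v i)).symm
  rw [I.left_inv, κ.base.left_inv hb] at h1
  ext v
  refine Eq.trans (congrArg (α (jet1 p φ x)) (funext fun i => ?_))
    -- The tangent map of the base chart is invertible, so every tangent vector arises from
    -- coordinate vectors.
    (h1 fun i => κ.dBase x (v i))
  exact congrArg (mfderiv I (jetModel I m) (jet1 p φ) x) (κ.dBaseSymm_dBase hb (v i)).symm

lemma apply_jetOfCoord_eq_zero (hφ : IsLocalSection p U φ)
    (κ : FiberedChart I (FibreSpace m) p.proj) {u : BaseSpace n}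
    (hu : u ∈ I.symm ⁻¹' modelDomain U φ κ ∩ range I) {k : ℕ}
    {α : DForm (jetModel I m) (Jet p) k}
    (h : DForm.pullback (I := I) (jet1 p φ) α (κ.base.symm (I.symm u)) = 0)
    (v : Fin k → BaseSpace n) :
    α (jetOfCoord κ φ u) (fun i =>
      mfderivWithin 𝓘(ℝ, BaseSpace n) (jetModel I m) (jetOfCoord κ φ) (range I) u (v i)) = 0 := by
  refine Eq.trans (congrArg (α (jetOfCoord κ φ u)) (funext fun i => ?_))
    (DFunLike.congr_fun h (fun i => κ.dBaseSymm (I.symm u) (v i)))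
  exact hφ.mfderivWithin_jetOfCoord κ hu (v i)

/-- A contact form vanishes along `j¹φ` over the whole open set `U`, not only at `x`, so naturality
of `d` applies to the prolongation parametrised by base coordinates. -/
lemma pullback_extD_of_isContact (hφ : IsLocalSection p U φ)
    {θ : DForm (jetModel I m) (Jet p) 1} (hθ : IsContact p θ) {x : X} (hx : x ∈ U) :
    DForm.pullback (I := I) (jet1 p φ) θ.extD x = 0 := by
  have hd := hφ.mem_domain_jet1 hx
  set κ := p.fiberedChartAt (jet1 p φ x).pt with hκ
  have hu := hφ.extend_base_mem κ hd
  refine hφ.pullback_jet1_eq_zero κ hd fun v => ?_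
  refine DForm.extD_comp_mfderivWithin_eq_zero hθ.isSmooth I.uniqueDiffOn hu.2
    (I.range_subset_closure_interior hu.2) (hφ.contMDiffWithinAt_jetOfCoord _ hu) ?_ v
  filter_upwards [hφ.modelDomain_mem_nhdsWithin κ hu] with w hw v
  exact hφ.apply_jetOfCoord_eq_zero κ hw (hθ.pullback_eq_zero U φ hφ _ hw.1.2.1) v

/-- Elements of the contact ideal vanish along prolongations of sections. -/
lemma pullback_of_inContactIdeal (hφ : IsLocalSection p U φ) {k : ℕ}
    {α : DForm (jetModel I m) (Jet p) k} (hα : InContactIdeal p k α) {x : X} (hx : x ∈ U) :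
    DForm.pullback (I := I) (jet1 p φ) α x = 0 := by
  induction hα with
  | zero k => ext v; rfl
  | add _ _ h1 h2 =>
    ext v
    refine Eq.trans (congrArg₂ (fun a b : ℝ => a + b) (DFunLike.congr_fun h1 v)
      (DFunLike.congr_fun h2 v)) (add_zero 0)
  | wedge_contact _ hθ =>
    exact wedgeForms_comp_eq_zero (E := BaseSpace n) (E' := JetSpace n m) _ _ _
      (hθ.pullback_eq_zero U φ hφ x hx)
  | wedge_extD _ hθ =>
    exact wedgeForms_comp_eq_zero (E := BaseSpace n) (E' := JetSpace n m) _ _ _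
      (hφ.pullback_extD_of_isContact hθ hx)

end IsLocalSection

/-- The exterior derivative at `y` is computed in the chart at `y`. Keeping the chart at an equal
point `z` lets the lemma apply where the two agree only propositionally. -/
lemma Jet.extD_poincareCartan_apply {η : DForm I X (n + 1)} (hη : η.IsSmooth) {L : Jet p → ℝ}
    (hL : ContMDiff (jetModel I m) 𝓘(ℝ, ℝ) ∞ L) {y z : Jet p} (hy : y = z)
    (v : Fin (n + 2) → JetSpace n m) :
    (poincareCartan p η L).extD y v =
      extDerivWithin (localCartan (localLagrangian p η L (p.fiberedChartAt z.pt) z)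
        (range (jetModel I m))) (range (jetModel I m)) (extChartAt (jetModel I m) z y)
        (fun i => mfderiv (jetModel I m) 𝓘(ℝ, JetSpace n m) (extChartAt (jetModel I m) z) y
          (v i)) := by
  subst hy
  have h : (poincareCartan p η L).inChart y =ᶠ[𝓝[range (jetModel I m)]
      (extChartAt (jetModel I m) y y)]
      localCartan (localLagrangian p η L (p.fiberedChartAt y.pt) y) (range (jetModel I m)) := by
    filter_upwards [extChartAt_target_mem_nhdsWithin (I := jetModel I m) y] with q hq
      using Jet.inChart_poincareCartan hη hL y hq
  have h' := h.extDerivWithin_eq (Jet.inChart_poincareCartan hη hL y (mem_extChartAt_target y))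
  exact DFunLike.congr_fun h' _

namespace IsEulerLagrange

variable {U : Set X} {φ : X → Y} {η : DForm I X (n + 1)} {L : Jet p → ℝ}

lemma extDerivWithin_localCartan_jetInCoord (hη : η.IsSmooth)
    (hL : ContMDiff (jetModel I m) 𝓘(ℝ, ℝ) ∞ L)
    (hφ : IsLocalSection p U φ) (hEL : IsEulerLagrange p η L U φ) {x : X} (hx : x ∈ U)
    (w : JetSpace n m) :
    extDerivWithin (localCartan (localLagrangian p η L (p.fiberedChartAt (jet1 p φ x).pt)
      (jet1 p φ x)) (range (jetModel I m))) (range (jetModel I m))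
      (jetInCoord p (p.fiberedChartAt (jet1 p φ x).pt) φ
        (I ((p.fiberedChartAt (jet1 p φ x).pt).base x)))
      (Matrix.vecCons w fun ν => fderivWithin ℝ
        (jetInCoord p (p.fiberedChartAt (jet1 p φ x).pt) φ) (range I)
        (I ((p.fiberedChartAt (jet1 p φ x).pt).base x)) (coordVec ν)) = 0 := by
  have hd := hφ.mem_domain_jet1 hx
  have hΛ := Jet.contDiffOn_localLagrangian hη hL (jet1 p φ x)
  have hopen := Jet.isOpen_chartAt_target (p := p) (jet1 p φ x)
  have hmem : (chartAt (Jet.Model H n m) (jet1 p φ x)) (jet1 p φ x) ∈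
      (chartAt (Jet.Model H n m) (jet1 p φ x)).target :=
    (chartAt (Jet.Model H n m) (jet1 p φ x)).map_source (mem_chart_source _ _)
  have hnh := Jet.preimage_target_mem_nhdsWithin (p := p) (jet1 p φ x) hmem
  have hmem' := Jet.mem_preimage_target (p := p) (jet1 p φ x) hmem
  -- The junk value in `IsEulerLagrange` is the jet itself, so its local Lagrangian is the one in
  -- the preferred chart at that jet.
  have hel := hEL (p.fiberedChartAt (jet1 p φ x).pt) x hx hd.2
  have hΛ' := hΛ.fderivWithin_range hopen
  have hΘ := contDiffOn_localCartan hΛ hΛ'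
  have hu := hφ.extend_base_mem _ hd
  have hb := hφ.mem_base_source _ hd
  have hσu : jetInCoord p (p.fiberedChartAt (jet1 p φ x).pt) φ
      (I ((p.fiberedChartAt (jet1 p φ x).pt).base x)) =
      jetModel I m ((chartAt (Jet.Model H n m) (jet1 p φ x)) (jet1 p φ x)) := by
    rw [jetInCoord, I.left_inv, OpenPartialHomeomorph.left_inv _ hb]
    rfl
  have hσ := ((hφ.contDiffOn_jetInCoord _ _ hu).differentiableWithinAt
    (by simp)).mono_of_mem_nhdsWithin (hφ.modelDomain_mem_nhdsWithin _ hu)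
  rw [← hσu] at hnh hmem'
  exact extDerivWithin_localCartan_eq_zero
    ((jetModel I m).uniqueDiffOn _ (mem_range_self _)) (I.uniqueDiffOn _ (mem_range_self _))
    (((hΛ _ hmem').differentiableWithinAt (by simp)).mono_of_mem_nhdsWithin hnh)
    (((hΛ' _ hmem').differentiableWithinAt (by simp)).mono_of_mem_nhdsWithin hnh)
    (((hΘ _ hmem').differentiableWithinAt (by simp)).mono_of_mem_nhdsWithin hnh)
    hσ.hasFDerivWithinAt (fun _ _ => mem_range_self _)
    (hφ.fderivWithin_jetInCoord_fst _ hu) hel w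

/-- Along a solution of the Euler-Lagrange equations, `(j¹φ)^* (ι_ξ dΘ_L) = 0` for every `ξ`. -/
lemma pullback_contract_extD (hη : η.IsSmooth)
    (hL : ContMDiff (jetModel I m) 𝓘(ℝ, ℝ) ∞ L)
    (hφ : IsLocalSection p U φ) (hEL : IsEulerLagrange p η L U φ)
    (ξ : VField (jetModel I m) (Jet p)) {x : X} (hx : x ∈ U) :
    DForm.pullback (I := I) (jet1 p φ) (DForm.contract ξ (poincareCartan p η L).extD) x = 0 := by
  have : IsManifold (jetModel I m) 1 (Jet p) := IsManifold.of_le (n := ∞) (by simp)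
  have hd := hφ.mem_domain_jet1 hx
  have hzero := hEL.extDerivWithin_localCartan_jetInCoord hη hL hφ hx
  obtain ⟨z, hz⟩ : ∃ z, z = jet1 p φ x := ⟨_, rfl⟩
  rw [← hz] at hd hzero
  have hu := hφ.extend_base_mem _ hd
  have hb := hφ.mem_base_source _ hd
  have hy : IsLocalSection.jetOfCoord (p.fiberedChartAt z.pt) φ
      (I ((p.fiberedChartAt z.pt).base x)) = z := by
    rw [IsLocalSection.jetOfCoord, Function.comp_apply, Function.comp_apply, I.left_inv,
      OpenPartialHomeomorph.left_inv _ hb, hz]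
  have hg := (hφ.contMDiffWithinAt_jetOfCoord z hu).mdifferentiableWithinAt (by simp)
  have hsrc : IsLocalSection.jetOfCoord (p.fiberedChartAt z.pt) φ
      (I ((p.fiberedChartAt z.pt).base x)) ∈ (extChartAt (jetModel I m) z).source := by
    rw [hy]
    exact mem_extChartAt_source z
  refine hφ.pullback_jet1_eq_zero _ hd fun v => ?_
  set β : BaseSpace n [⋀^Fin (n + 1)]→L[ℝ] ℝ :=
    ContinuousAlternatingMap.compContinuousLinearMap (M := JetSpace n m) (M' := BaseSpace n)
      (DForm.contract ξ (poincareCartan p η L).extD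
        (IsLocalSection.jetOfCoord (p.fiberedChartAt z.pt) φ
          (I ((p.fiberedChartAt z.pt).base x))))
      (mfderivWithin 𝓘(ℝ, BaseSpace n) (jetModel I m)
        (IsLocalSection.jetOfCoord (p.fiberedChartAt z.pt) φ) (range I)
        (I ((p.fiberedChartAt z.pt).base x))) with hβ
  -- A top-degree form is determined by its value on the coordinate frame, so only the vectors `σ'
  -- e_ν` need to be inserted.
  suffices h : β coordVec = 0 by
    have h' := eq_smul_volForm β
    rw [h, zero_smul] at h'
    exact DFunLike.congr_fun h' v
  refine (Jet.extD_poincareCartan_apply hη hL hy _).trans ?_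
  refine Eq.trans (congrArg _ (funext fun i => ?_)) (hzero (mfderiv (jetModel I m)
    𝓘(ℝ, JetSpace n m) (extChartAt (jetModel I m) z)
      (IsLocalSection.jetOfCoord (p.fiberedChartAt z.pt) φ (I ((p.fiberedChartAt z.pt).base x)))
      (ξ (IsLocalSection.jetOfCoord (p.fiberedChartAt z.pt) φ
        (I ((p.fiberedChartAt z.pt).base x))))))
  refine Fin.cases rfl (fun ν => ?_) i
  exact (fderivWithin_extChartAt_comp (I.uniqueDiffOn _ hu.2) hg hsrc (coordVec ν)).symm

end IsEulerLagrange

end Noether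

theorem mainTheorem1 {n m : ℕ}
    {H : Type*} [TopologicalSpace H] {I : ModelWithCorners ℝ (BaseSpace n) H}
    {X : Type*} [TopologicalSpace X] [T2Space X] [SecondCountableTopology X]
    [ChartedSpace H X] [IsManifold I ∞ X]
    {Y : Type*} [TopologicalSpace Y] [T2Space Y] [SecondCountableTopology Y]
    [ChartedSpace (ModelProd H (FibreSpace m)) Y] [IsManifold (totalModel I m) ∞ Y]
    (p : Fibration I (FibreSpace m) X Y)
    (η : DForm I X (n + 1)) (hη : η.IsSmooth) (hη0 : ∀ x, η x ≠ 0)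
    (L : Jet p → ℝ) (hL : ContMDiff (jetModel I m) 𝓘(ℝ, ℝ) ∞ L)
    {b : ℕ} {B : Type*} [TopologicalSpace B] [T2Space B] [SecondCountableTopology B]
    [ChartedSpace (EuclideanSpace ℝ (Fin b)) B] [IsManifold (𝓡 b) ∞ B]
    (iB : B → Jet p) (hB : IsBoundaryCondition p b iB)
    (Pi : DForm (𝓡 b) B n) (hPi : Pi.IsSmooth)
    (hΘ : DForm.pullback iB (poincareCartan p η L) = Pi.extD)
    (ξY : VField (totalModel I m) Y) (hξY : IsSmoothVectorField ξY)
    (ξZ : VField (jetModel I m) (Jet p))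
    (hsymm : IsLagrangianSymmetry p η L iB Pi ξY ξZ) :
    IsPreservedQuantity p η L (DForm.contract ξZ (poincareCartan p η L)) ∧
      (DForm.pullback (I := 𝓡 b) iB (DForm.contract ξZ (poincareCartan p η L))).IsExact := by
  have hΘs := Jet.isSmooth_poincareCartan (p := p) hη hL
  refine ⟨⟨hΘs.contract hsymm.isProlongation.isSmooth, fun U φ hφ hEL x hx => ?_⟩, ?_⟩
  · have h1 := hφ.pullback_of_inContactIdeal hsymm.lieD_mem hx
    have h2 := hEL.pullback_contract_extD hη hL hφ ξZ hx
    -- By Cartan's formula the vanishing pullback of `£_ξ Θ` is the sum of those of `d (ι_ξ Θ)` and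
    -- `ι_ξ dΘ`; the second is zero by `h2`.
    rw [DForm.lieD_eq_extD_contract_add hsymm.isProlongation.isSmooth hΘs] at h1
    ext v
    have h3 : (_ : ℝ) + _ = 0 := DFunLike.congr_fun h1 v
    have h4 := DFunLike.congr_fun h2 v
    exact (eq_neg_of_add_eq_zero_left h3).trans ((congrArg Neg.neg h4).trans neg_zero)
  · obtain ⟨ζ, hζ, htan, hlie⟩ := hsymm.tangent
    -- Contraction commutes with pullback because `ζ` and `ξZ` are related by `iB`; then `i_B^* Θ =
    -- dΠ`.
    have hpull : DForm.pullback (I := 𝓡 b) iB (DForm.contract ξZ (poincareCartan p η L)) =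
        DForm.contract ζ Pi.extD := by
      rw [← hΘ]
      funext β
      ext v
      refine congrArg (poincareCartan p η L (iB β)) (funext fun i => ?_)
      exact Fin.cases (htan β).symm (fun _ => rfl) i
    rw [hpull]
    cases n with
    -- `Π` is a function here, so `ι_ζ dΠ = £_ζ Π = 0`.
    | zero => exact (DForm.lieD_eq_contract_extD ζ Pi).symm.trans hlie
    | succ k =>
      -- From `0 = £_ζ Π = d (ι_ζ Π) + ι_ζ dΠ` the primitive is `-ι_ζ Π`.
      refine ⟨-DForm.contract ζ Pi, (hPi.contract hζ).neg, ?_⟩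
      rw [DForm.lieD_eq_extD_contract_add hζ hPi] at hlie
      rw [DForm.extD_neg]
      exact neg_eq_of_add_eq_zero_right hlie
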